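/- Let $A$ be a unital $C^*$-algebra, and let $A^{\otimes(n+1)}_\gamma$ be the completed $(n+1)$-fold projective tensor power of $A$ (a Banach algebra). For $a\in A$ let $a^{(j)}=1\otimes\cdots\otimes a\otimes\cdots\otimes 1$ ($a$ in slot $j$, $0\le j\le n$) and $\nabla_a^{(j)}=-a^{(j-1)}+a^{(j)}$ ($1\le j\le n$), elements of $A^{\otimes(n+1)}_\gamma$; write $\nabla_a=\nabla_a^{(1)}=-a\otimes 1+1\otimes a$ for $n=1$. Let $\mu_n:A^{\otimes(n+1)}_\gamma\to A$ be the continuous extension of $a_0\otimes\cdots\otimes a_n\mapsto a_0\cdots a_n$, and for $T\in A^{\otimes(n+1)}_\gamma$ and $b_1,\dots,b_n\in A$ put $T(b_1\cdots b_n)=\mu_n\big(T\,(b_1\otimes\cdots\otimes b_n\otimes 1)\big)$. For $a$ selfadjoint and $F$ smooth on $\mathbb R^n$, let $$F_\gamma(\nabla_a^{(1)},\dots,\nabla_a^{(n)})=\int_{\mathbb R^n}\hat g(\xi)\,\exp\big(2\pi i\textstyle\sum_j\xi_j\nabla_a^{(j)}\big)\,d\xi\in A^{\otimes(n+1)}_\gamma,\qquad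 \hat g(\xi)=\int_{\mathbb R^n} g(y)e^{-2\pi i\langle y,\xi\rangle}dy,$$ where $g$ is any Schwartz function which agrees with $F$ in a neighbourhood of $\{(x_1-x_0,\dots,x_n-x_{n-1}) : x_0,\dots,x_n\in\operatorname{spec}a\}$ (the choice of $g$ does not matter). Let $[x_0,\dots,x_n]f=\int_{s_j\ge0,\ \sum_{j=0}^n s_j=1}f^{(n)}\big(\sum_j s_jx_j\big)\,ds_1\cdots ds_n$ be the divided difference of $f$ (confluent arguments included); an expression such as $[\nabla_a^{(1)}+\nabla_a^{(2)},\nabla_a^{(2)}]f_\gamma$ means that the $\nabla_a^{(j)}$ are inserted into the corresponding function, here $(s,t)\mapsto[s+t,t]f$, by this calculus. Let $a,x\in A$ be selfadjoint and let $f\in\mathcal S(\mathbb R)$ be a (complex-valued) Schwartz function. Then, for selfadjoint $b\in A$ with $b\to0$, $$\begin{aligned} f(\nabla_{a+b})(x)={}&f(\nabla_a)(x)\\ &-\big([\nabla_a^{(1)}+\nabla_a^{(2)},\nabla_a^{(2)}]f_\gamma\big)(b\cdot x)+\big([\nabla_a^{(1)}+\nabla_a^{(2)},\nabla_a^{(1)}]f_\gamma\big)(x\cdot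 b)\\ &+\big([\nabla_a^{(1)}+\nabla_a^{(2)}+\nabla_a^{(3)},\nabla_a^{(2)}+\nabla_a^{(3)},\nabla_a^{(3)}]f_\gamma\big)(b\cdot b\cdot x)\\ &+\big([\nabla_a^{(1)},\nabla_a^{(1)}+\nabla_a^{(2)},\nabla_a^{(1)}+\nabla_a^{(2)}+\nabla_a^{(3)}]f_\gamma\big)(x\cdot b\cdot b)\\ &-\big([\nabla_a^{(1)}+\nabla_a^{(2)},\nabla_a^{(1)}+\nabla_a^{(2)}+\nabla_a^{(3)},\nabla_a^{(2)}+\nabla_a^{(3)}]f_\gamma\big)(b\cdot x\cdot b)\\ &-\big([\nabla_a^{(1)}+\nabla_a^{(2)},\nabla_a^{(2)},\nabla_a^{(2)}+\nabla_a^{(3)}]f_\gamma\big)(b\cdot x\cdot b)+O(\|b\|^3). \end{aligned}$$ The two-variable functions in the linear term are $-[s+t,t]f=-\frac{f(s+t)-f(t)}{s}$ for $s\ne0$ and $[s+t,s]f=\frac{f(s+t)-f(s)}{t}$ for $t\ne0$. -/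

import Mathlib

open scoped TensorProduct SchwartzMap FourierTransform Topology

noncomputable section

namespace NablaExpansion

/-! ### The projective tensor powers of a unital C*-algebra

Mathlib's norm on `⨂[ℂ] _ : Fin (n + 1), A` is the projective seminorm. -/

section ProjectiveTensor

variable (A : Type*) [CStarAlgebra A] (n : ℕ)

theorem norm_tprod_mul_tprod_le (u v : Fin (n + 1) → A) :
    ‖PiTensorProduct.tprod ℂ u * PiTensorProduct.tprod ℂ v‖
      ≤ (∏ i, ‖v i‖) * ∏ i, ‖u i‖ := by
  rw [PiTensorProduct.tprod_mul_tprod, mul_comm, ← Finset.prod_mul_distrib]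
  exact (PiTensorProduct.projectiveSeminorm_tprod_le (𝕜 := ℂ) (u * v)).trans
    (Finset.prod_le_prod (fun i _ => norm_nonneg _) (fun i _ => norm_mul_le (u i) (v i)))

theorem norm_mul_tprod_le (x : ⨂[ℂ] _ : Fin (n + 1), A) (v : Fin (n + 1) → A) :
    ‖x * PiTensorProduct.tprod ℂ v‖ ≤ ‖x‖ * ∏ i, ‖v i‖ := by
  let L : (⨂[ℂ] _ : Fin (n + 1), A) →ₗ[ℂ] (⨂[ℂ] _ : Fin (n + 1), A) :=
    LinearMap.mulRight ℂ (PiTensorProduct.tprod ℂ v)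
  let M : ContinuousMultilinearMap ℂ (fun _ : Fin (n + 1) => A) (⨂[ℂ] _ : Fin (n + 1), A) :=
    (L.compMultilinearMap (PiTensorProduct.tprod ℂ)).mkContinuous (∏ i, ‖v i‖)
      (fun u => norm_tprod_mul_tprod_le A n u v)
  have hM : ‖M‖ ≤ ∏ i, ‖v i‖ :=
    MultilinearMap.mkContinuous_norm_le _ (Finset.prod_nonneg fun i _ => norm_nonneg _) _
  have h := PiTensorProduct.norm_eval_le_projectiveSeminorm M x
  have hL : PiTensorProduct.lift M.toMultilinearMap = L := by
    ext u
    simp only [M, LinearMap.compMultilinearMap_apply, PiTensorProduct.lift.tprod]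
    rfl
  rw [hL] at h
  calc ‖L x‖ ≤ ‖M‖ * ‖x‖ := h
    _ ≤ (∏ i, ‖v i‖) * ‖x‖ := by gcongr
    _ = _ := mul_comm _ _

theorem norm_mul_le_projective (x y : ⨂[ℂ] _ : Fin (n + 1), A) : ‖x * y‖ ≤ ‖x‖ * ‖y‖ := by
  let L : (⨂[ℂ] _ : Fin (n + 1), A) →ₗ[ℂ] (⨂[ℂ] _ : Fin (n + 1), A) := LinearMap.mulLeft ℂ x
  let M : ContinuousMultilinearMap ℂ (fun _ : Fin (n + 1) => A) (⨂[ℂ] _ : Fin (n + 1), A) :=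
    (L.compMultilinearMap (PiTensorProduct.tprod ℂ)).mkContinuous ‖x‖
      (fun u => norm_mul_tprod_le A n x u)
  have hM : ‖M‖ ≤ ‖x‖ := MultilinearMap.mkContinuous_norm_le _ (norm_nonneg _) _
  have h := PiTensorProduct.norm_eval_le_projectiveSeminorm M y
  have hL : PiTensorProduct.lift M.toMultilinearMap = L := by
    ext u
    simp only [M, LinearMap.compMultilinearMap_apply, PiTensorProduct.lift.tprod]
    rfl
  rw [hL] at h
  calc ‖L y‖ ≤ ‖M‖ * ‖y‖ := h
    _ ≤ ‖x‖ * ‖y‖ := by gcongr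

instance instSeminormedRing : SeminormedRing (⨂[ℂ] _ : Fin (n + 1), A) where
  __ := (inferInstance : SeminormedAddCommGroup (⨂[ℂ] _ : Fin (n + 1), A))
  __ := (inferInstance : Ring (⨂[ℂ] _ : Fin (n + 1), A))
  norm_mul_le := norm_mul_le_projective A n

instance instNormedAlgebra : NormedAlgebra ℂ (⨂[ℂ] _ : Fin (n + 1), A) where
  __ := (inferInstance : Algebra ℂ (⨂[ℂ] _ : Fin (n + 1), A))
  norm_smul_le := norm_smul_le

/-- The completed `(n+1)`-fold projective tensor power of `A`, a Banach algebra. -/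
abbrev ProjTensor : Type _ := UniformSpace.Completion (⨂[ℂ] _ : Fin (n + 1), A)

instance instNormedAlgebraProjTensor : NormedAlgebra ℂ (ProjTensor A n) where
  __ := (inferInstance : Algebra ℂ (ProjTensor A n))
  norm_smul_le := norm_smul_le

end ProjectiveTensor

variable {A : Type*} [CStarAlgebra A] {n : ℕ}

/-- The elementary tensor `a₀ ⊗ ⋯ ⊗ aₙ`. -/
def elem (u : Fin (n + 1) → A) : ProjTensor A n :=
  ((PiTensorProduct.tprod ℂ u : ⨂[ℂ] _ : Fin (n + 1), A) : ProjTensor A n)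

/-- The multiplication map `a₀ ⊗ ⋯ ⊗ aₙ ↦ a₀ ⋯ aₙ`, extended by continuity to the completed
projective tensor power. -/
def mulMap (A : Type*) [CStarAlgebra A] (n : ℕ) : ProjTensor A n →L[ℂ] A :=
  (PiTensorProduct.liftIsometry ℂ (fun _ : Fin (n + 1) => A) A
    (ContinuousMultilinearMap.mkPiAlgebraFin ℂ (n + 1) A)).extend UniformSpace.Completion.toComplL

/-- The contraction `T(b₁ ⋯ bₙ) = μₙ(T · (b₁ ⊗ ⋯ ⊗ bₙ ⊗ 1))`. -/
def contract (T : ProjTensor A n) (b : Fin n → A) : A :=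
  mulMap A n (T * elem (Fin.snoc b 1 : Fin (n + 1) → A))

/-- `a⁽ʲ⁾ = 1 ⊗ ⋯ ⊗ a ⊗ ⋯ ⊗ 1`, with `a` in slot `j`; slots are counted from `0`. -/
def slot (a : A) (j : Fin (n + 1)) : ProjTensor A n := elem (Pi.mulSingle j a)

/-- `∇ₐ⁽ʲ⁺¹⁾ = - a⁽ʲ⁾ + a⁽ʲ⁺¹⁾` for `j = 0, …, n - 1`. -/
def nabla (a : A) (j : Fin n) : ProjTensor A n := -slot a j.castSucc + slot a j.succ

/-- The joint spectrum of `∇ₐ⁽¹⁾, …, ∇ₐ⁽ⁿ⁾`: the image of `(spec a)ⁿ⁺¹` under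
`x ↦ (x₁ - x₀, …, xₙ - xₙ₋₁)`. -/
def nablaSpectrum (a : A) (n : ℕ) : Set (EuclideanSpace ℝ (Fin n)) :=
  {y | ∃ x : Fin (n + 1) → ℝ, (∀ j, x j ∈ spectrum ℝ a) ∧
    ∀ j : Fin n, y j = -x j.castSucc + x j.succ}

/-- The functional calculus of Schwartz functions for `∇ₐ⁽¹⁾, …, ∇ₐ⁽ⁿ⁾`, through Fourier
inversion: the Bochner integral `∫ ĝ(ξ) exp(2πi (ξ₁∇ₐ⁽¹⁾ + ⋯ + ξₙ∇ₐ⁽ⁿ⁾)) dξ` in the completed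
projective tensor power. Here `ĝ(ξ) = ∫ g(y) exp(-2πi ⟨y, ξ⟩) dy`. -/
def schwartzCalc (a : A) (g : 𝓢(EuclideanSpace ℝ (Fin n), ℂ)) : ProjTensor A n :=
  ∫ ξ : EuclideanSpace ℝ (Fin n),
    (𝓕 g) ξ • NormedSpace.exp
      ((2 * Real.pi * Complex.I : ℂ) • ∑ j : Fin n, ((ξ j : ℝ) : ℂ) • nabla a j)

open Classical in
/-- The smooth functional calculus `F_γ(∇ₐ⁽¹⁾, …, ∇ₐ⁽ⁿ⁾)`: the Schwartz calculus applied to a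
Schwartz function which agrees with `F` near the joint spectrum. (Such a function exists when `F` is
smooth near the joint spectrum, and the result does not depend on its choice.) -/
def nablaCalc (a : A) (F : EuclideanSpace ℝ (Fin n) → ℂ) : ProjTensor A n :=
  if h : ∃ g : 𝓢(EuclideanSpace ℝ (Fin n), ℂ), ∀ᶠ y in 𝓝ˢ (nablaSpectrum a n), g y = F y then
    schwartzCalc a h.choose
  else 0

/-- The divided difference `[x₀, …, xₙ]f` of a smooth function, confluent arguments included, by the
Genocchi–Hermite formula: the integral of `f⁽ⁿ⁾(s₀x₀ + ⋯ + sₙxₙ)` over the simplex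
`s₀ + ⋯ + sₙ = 1`, `sⱼ ≥ 0`, with respect to `ds₁ ⋯ dsₙ`. -/
def dividedDiff (f : ℝ → ℂ) (x : Fin (n + 1) → ℝ) : ℂ :=
  ∫ s in {s : Fin n → ℝ | (∀ j, 0 ≤ s j) ∧ ∑ j, s j ≤ 1},
    iteratedDeriv n f ((1 - ∑ j, s j) * x 0 + ∑ j, s j * x j.succ)

/-- `f(∇ₐ)(x)`, where `∇ₐ = ∇ₐ⁽¹⁾ = - a ⊗ 1 + 1 ⊗ a`. -/
def nablaApply (f : ℝ → ℂ) (a x : A) : A :=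
  contract (nablaCalc a (fun y : EuclideanSpace ℝ (Fin 1) => f (y 0))) ![x]

end NablaExpansion

end

/-! Fourier inversion turns the calculus into a superposition of unitary conjugations: `f(∇ₐ)(x) = ∫
𝓕f(s) e^{-2πisa} x e^{2πisa} ds`. Replacing `a` by `a + b`, Duhamel's formula expands both
exponentials to second order in `b`. The error of the conjugation is at most `4 (2π|s|‖b‖)³ ‖x‖`,
because every exponential of a selfadjoint element has norm at most one; since `|s|³ 𝓕f(s)` is
integrable, this integrates to `O(‖b‖³)`.

It remains to recognise the Duhamel terms as divided differences. By Genocchi–Hermite, each divided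
difference in the statement is an average over a simplex of `f⁽ᵐ⁾(⟨v_t, y⟩)` with `v_t` affine in
`t`. Writing `f⁽ᵐ⁾` through its Fourier transform `(2πis)ᵐ 𝓕f(s)` makes it a superposition of plane
waves with frequencies `s v_t`. Inserting the `∇ₐ⁽ʲ⁾` sends each wave to an elementary tensor of
exponentials of `a`, and contraction gives exactly the Duhamel integrands
(`contract_nablaCalc_dividedDiff`). In the `b·x·b` order, the two divided differences fill the two
triangles of the unit square, which together give the product of two first-order Duhamel integrals.

The calculus, however, is defined through an arbitrary Schwartz function equal to the given one near
the joint spectrum, whereas the divided differences need not be Schwartz in `y`. The bridge is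
`integral_elem_congr`: a superposition of exponentials depends only on the corresponding
superposition of plane waves near the joint spectrum. -/

noncomputable section

namespace NablaExpansion

open MeasureTheory

/-! ### Exponentials and contractions of elementary tensors. -/

section Elementary

variable {A : Type*} [CStarAlgebra A] {n : ℕ}

/-- The map `(a₀, …, aₙ) ↦ a₀ ⊗ ⋯ ⊗ aₙ` as a continuous multilinear map. -/
def elemL (A : Type*) [CStarAlgebra A] (n : ℕ) :
    ContinuousMultilinearMap ℂ (fun _ : Fin (n + 1) => A) (ProjTensor A n) :=
  (UniformSpace.Completion.toComplL (𝕜 := ℂ)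
    (E := ⨂[ℂ] _ : Fin (n + 1), A)).compContinuousMultilinearMap (PiTensorProduct.tprodL ℂ)

theorem elemL_apply (u : Fin (n + 1) → A) : elemL A n u = elem u := by
  simp [elemL, elem]

theorem elem_mul (u v : Fin (n + 1) → A) : elem u * elem v = elem (u * v) := by
  rw [elem, elem, elem, ← UniformSpace.Completion.coe_mul, PiTensorProduct.tprod_mul_tprod]

theorem elem_one : elem (1 : Fin (n + 1) → A) = 1 := by
  rw [elem, ← PiTensorProduct.one_def, UniformSpace.Completion.coe_one]

/-- The embedding of `A` into slot `j` as a ring homomorphism. -/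
def slotHom (A : Type*) [CStarAlgebra A] {n : ℕ} (j : Fin (n + 1)) : A →+* ProjTensor A n where
  toFun a := slot a j
  map_one' := by rw [slot, Pi.mulSingle_one, elem_one]
  map_mul' a b := by rw [slot, slot, slot, elem_mul, Pi.mulSingle_mul]
  map_zero' := by
    have h := ((elemL A n).toContinuousLinearMap 1 j).map_zero
    rwa [ContinuousMultilinearMap.toContinuousLinearMap_apply, elemL_apply] at h
  map_add' a b := by
    have h := ((elemL A n).toContinuousLinearMap 1 j).map_add a b
    simp only [ContinuousMultilinearMap.toContinuousLinearMap_apply, elemL_apply] at h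
    exact h

theorem slot_smul (z : ℂ) (a : A) (j : Fin (n + 1)) : slot (z • a) j = z • slot a j := by
  have h := ((elemL A n).toContinuousLinearMap 1 j).map_smul z a
  simp only [ContinuousMultilinearMap.toContinuousLinearMap_apply, elemL_apply] at h
  exact h

theorem continuous_slot (j : Fin (n + 1)) : Continuous fun a : A => slot a j := by
  have h := ((elemL A n).toContinuousLinearMap 1 j).continuous
  refine h.congr fun a => ?_
  rw [ContinuousMultilinearMap.toContinuousLinearMap_apply, elemL_apply]
  rfl

theorem exp_slot (a : A) (j : Fin (n + 1)) :
    NormedSpace.exp (slot a j) = slot (NormedSpace.exp a) j := by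
  let +nondep : NormedAlgebra ℚ A := .restrictScalars ℚ ℂ A
  let +nondep : NormedAlgebra ℚ (ProjTensor A n) := .restrictScalars ℚ ℂ (ProjTensor A n)
  exact (NormedSpace.map_exp (slotHom A j) (continuous_slot j) a).symm

theorem commute_slot (a b : A) {i j : Fin (n + 1)} (hij : i ≠ j) :
    Commute (slot a i) (slot b j) := by
  rw [commute_iff_eq, slot, slot, elem_mul, elem_mul]
  congr 1
  funext k
  by_cases hi : k = i
  · subst hi; simp [hij]
  · simp [hi]

/-- Different slots commute, so the exponential of the sum factors slot by slot. -/
theorem exp_sum_slot (v : Fin (n + 1) → A) :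
    NormedSpace.exp (∑ i, slot (v i) i) = elem fun i => NormedSpace.exp (v i) := by
  let +nondep : NormedAlgebra ℚ (ProjTensor A n) := .restrictScalars ℚ ℂ (ProjTensor A n)
  have key (s : Finset (Fin (n + 1))) : NormedSpace.exp (∑ i ∈ s, slot (v i) i)
      = elem fun i => if i ∈ s then NormedSpace.exp (v i) else 1 := by
    induction s using Finset.induction_on with
    | empty =>
      simp only [Finset.sum_empty, NormedSpace.exp_zero, Finset.notMem_empty, if_false]
      exact elem_one.symm
    | insert j s hj ih =>
      have hc : Commute (slot (v j) j) (∑ i ∈ s, slot (v i) i) :=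
        Commute.sum_right _ _ _ fun i hi => commute_slot _ _ (by rintro rfl; exact hj hi)
      rw [Finset.sum_insert hj, NormedSpace.exp_add_of_commute hc, ih, exp_slot, slot, elem_mul]
      congr 1
      funext i
      by_cases h : i = j
      · subst h; simp [hj]
      · simp [h]
  simpa using key Finset.univ

/-- The exponents `(-ξ₁, ξ₁ - ξ₂, …, ξₙ)` of the slots in `∑ ξⱼ ∇⁽ʲ⁾`. -/
def slotExponent (ξ : Fin n → ℝ) (i : Fin (n + 1)) : ℝ :=
  (Fin.cons 0 ξ : Fin (n + 1) → ℝ) i - (Fin.snoc ξ 0 : Fin (n + 1) → ℝ) i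

/-- Summation by parts, with `ξ` padded by zero at either end. -/
theorem sum_slotExponent_smul {M : Type*} [AddCommGroup M] [Module ℂ M] (ξ : Fin n → ℝ)
    (v : Fin (n + 1) → M) :
    ∑ i, (slotExponent ξ i : ℂ) • v i = ∑ j, (ξ j : ℂ) • (-v j.castSucc + v j.succ) := by
  simp only [slotExponent, Complex.ofReal_sub, sub_smul, Finset.sum_sub_distrib, smul_add, smul_neg,
    Finset.sum_add_distrib, Finset.sum_neg_distrib]
  rw [Fin.sum_univ_succ, Fin.sum_univ_castSucc (n := n)]
  simp [sub_eq_neg_add]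

theorem continuous_slotExponent : Continuous (slotExponent : (Fin n → ℝ) → Fin (n + 1) → ℝ) := by
  refine continuous_pi fun i => Continuous.sub ?_ ?_
  · refine Fin.cases ?_ (fun j => ?_) i
    · simpa using continuous_const
    · simpa using continuous_apply j
  · refine Fin.lastCases ?_ (fun j => ?_) i
    · simpa using continuous_const
    · simpa using continuous_apply j

/-- `exp (2πi t c)`. -/
def phase (c : A) (t : ℝ) : A := NormedSpace.exp ((2 * Real.pi * Complex.I * t : ℂ) • c)

theorem exp_nabla (a : A) (ξ : Fin n → ℝ) :
    NormedSpace.exp ((2 * Real.pi * Complex.I : ℂ) • ∑ j : Fin n, ((ξ j : ℝ) : ℂ) • nabla a j)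
      = elem fun i => phase a (slotExponent ξ i) := by
  have h := sum_slotExponent_smul ξ (fun i => slot a i)
  simp only [nabla, phase]
  rw [← h, ← exp_sum_slot, Finset.smul_sum]
  simp only [slot_smul, smul_smul]

theorem mulMap_elem (u : Fin (n + 1) → A) : mulMap A n (elem u) = (List.ofFn u).prod := by
  rw [mulMap, elem, ← UniformSpace.Completion.coe_toComplL (𝕜 := ℂ),
    ContinuousLinearMap.extend_eq _ UniformSpace.Completion.denseRange_coe
      (UniformSpace.Completion.isUniformInducing_coe _)]
  simp

/-- The contraction with `b` as a continuous linear map. -/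
def contractL (b : Fin n → A) : ProjTensor A n →L[ℂ] A :=
  (mulMap A n).comp ((ContinuousLinearMap.mul ℂ (ProjTensor A n)).flip
    (elem (Fin.snoc b 1 : Fin (n + 1) → A)))

theorem contractL_apply (b : Fin n → A) (T : ProjTensor A n) : contractL b T = contract T b := rfl

theorem contract_elem (u : Fin (n + 1) → A) (b : Fin n → A) :
    contract (elem u) b = (List.ofFn (u * (Fin.snoc b 1 : Fin (n + 1) → A))).prod := by
  rw [contract, elem_mul, mulMap_elem]

theorem contract_elem_one (u : Fin 2 → A) (b : A) : contract (elem u) ![b] = u 0 * b * u 1 := by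
  simp [contract_elem]

theorem contract_elem_two (u : Fin 3 → A) (b c : A) :
    contract (elem u) ![b, c] = u 0 * b * u 1 * c * u 2 := by
  simp [contract_elem, mul_assoc]

theorem contract_elem_three (u : Fin 4 → A) (b c d : A) :
    contract (elem u) ![b, c, d] = u 0 * b * u 1 * c * u 2 * d * u 3 := by
  simp [contract_elem, mul_assoc]

end Elementary

end NablaExpansion

namespace NablaExpansion

open MeasureTheory

/-! ### The one-parameter unitary groups of selfadjoint elements. -/

section Phase

variable {A : Type*} [CStarAlgebra A]

theorem phase_zero (c : A) : phase c 0 = 1 := by simp [phase]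

theorem continuous_phase (c : A) : Continuous (phase c) := by
  let +nondep : NormedAlgebra ℚ A := .restrictScalars ℚ ℂ A
  exact NormedSpace.exp_continuous.comp (by fun_prop)

theorem norm_phase_le {c : A} (hc : IsSelfAdjoint c) (t : ℝ) : ‖phase c t‖ ≤ 1 := by
  -- Unitaries have norm one only when `A ≠ 0`; the zero algebra is treated separately.
  rcases subsingleton_or_nontrivial A with h | h
  · rw [Subsingleton.elim (phase c t) 0, norm_zero]; exact zero_le_one
  · have hs : IsSelfAdjoint ((2 * Real.pi * t : ℝ) • c) := (IsSelfAdjoint.all (2 * Real.pi * t : ℝ)).smul hc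
    have h1 : phase c t = (selfAdjoint.expUnitary ⟨_, hs⟩ : unitary A) := by
      rw [selfAdjoint.expUnitary_coe, phase]
      change _ = NormedSpace.exp (Complex.I • ((2 * Real.pi * t : ℝ) • c))
      rw [← Complex.coe_smul (2 * Real.pi * t) c, smul_smul]
      congr 2
      push_cast; ring
    rw [h1]
    exact (CStarRing.norm_coe_unitary _).le

theorem phase_eq_cfc {c : A} (hc : IsSelfAdjoint c) (t : ℝ) :
    phase c t = cfc (fun z : ℂ => Complex.exp (2 * Real.pi * Complex.I * t * z)) c := by
  have hn : IsStarNormal c := hc.isStarNormal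
  have hn' : IsStarNormal ((2 * Real.pi * Complex.I * t : ℂ) • c) := inferInstance
  rw [phase, ← CFC.exp_eq_normedSpace_exp (𝕜 := ℂ), Complex.exp_eq_exp_ℂ]
  rw [← cfc_comp_smul (2 * Real.pi * Complex.I * t : ℂ) NormedSpace.exp c]
  simp only [smul_eq_mul]

theorem fourierInversion_one (φ : 𝓢(ℝ, ℂ)) (x : ℝ) :
    ∫ ζ, 𝓕 φ ζ * Complex.exp (2 * Real.pi * Complex.I * ζ * x) = φ x := by
  have h0 : 𝓕⁻ (𝓕 φ : 𝓢(ℝ, ℂ)) = φ := FourierTransform.fourierInv_fourier_eq φ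
  have h := congrArg (fun g : 𝓢(ℝ, ℂ) => g x) h0
  simp only [SchwartzMap.fourierInv_coe, Real.fourierInv_eq'] at h
  rw [← h]
  refine integral_congr_ae (.of_forall fun ζ => ?_)
  simp only [smul_eq_mul, RCLike.inner_apply, conj_trivial]
  rw [mul_comm]
  congr 2
  push_cast; ring

/-- The shifted transform `𝓕φ(ζ - t)` belongs to `x ↦ φ(x) e^{2πitx}`, which equals `e^{2πitx}` on
the spectrum. The continuous functional calculus sees nothing else, so the cutoff `φ` is inserted at
no cost; this is the source of locality. -/
theorem phase_eq_integral {c : A} (hc : IsSelfAdjoint c) (φ : 𝓢(ℝ, ℂ))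
    (hφ : ∀ x ∈ spectrum ℝ c, φ x = 1) (t : ℝ) :
    phase c t = ∫ ζ, 𝓕 φ (ζ - t) • phase c ζ := by
  have hn : IsStarNormal c := hc.isStarNormal
  have hre : ∀ z ∈ spectrum ℂ c, ∃ x : ℝ, x ∈ spectrum ℝ c ∧ z = x := by
    intro z hz
    have h := hc.mem_spectrum_eq_re hz
    refine ⟨z.re, ?_, h⟩
    rw [h] at hz
    exact spectrum.of_algebraMap_mem ℂ hz
  have hint : Integrable fun ζ => 𝓕 φ (ζ - t) := (𝓕 φ).integrable.comp_sub_right t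
  have h1 : ∀ ζ : ℝ, 𝓕 φ (ζ - t) • phase c ζ
      = cfc (fun z : ℂ => 𝓕 φ (ζ - t) * Complex.exp (2 * Real.pi * Complex.I * ζ * z)) c := by
    intro ζ
    rw [phase_eq_cfc hc, cfc_const_mul _ _ _ (by fun_prop)]
  simp_rw [h1]
  rw [← cfc_integral (fun (ζ : ℝ) (z : ℂ) =>
    𝓕 φ (ζ - t) * Complex.exp (2 * Real.pi * Complex.I * ζ * z)) (fun ζ => ‖𝓕 φ (ζ - t)‖) c]
  · rw [phase_eq_cfc hc]
    refine cfc_congr fun z hz => ?_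
    obtain ⟨x, hx, rfl⟩ := hre z hz
    rw [← integral_add_right_eq_self _ t]
    simp only [add_sub_cancel_right]
    have h2 : ∀ ζ : ℝ, 𝓕 φ ζ * Complex.exp (2 * Real.pi * Complex.I * (ζ + t : ℝ) * x)
        = 𝓕 φ ζ * Complex.exp (2 * Real.pi * Complex.I * ζ * x)
          * Complex.exp (2 * Real.pi * Complex.I * t * x) := by
      intro ζ
      rw [mul_assoc (𝓕 φ ζ), ← Complex.exp_add]
      congr 2
      push_cast; ring
    simp_rw [h2]
    rw [integral_mul_const, fourierInversion_one, hφ x hx, one_mul]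
  · have := (𝓕 φ).continuous
    exact Continuous.continuousOn (by unfold Function.uncurry; fun_prop)
  · refine .of_forall fun ζ z hz => ?_
    obtain ⟨x, hx, rfl⟩ := hre z hz
    rw [norm_mul, show 2 * Real.pi * Complex.I * ζ * x = ((2 * Real.pi * ζ * x : ℝ) : ℂ) * Complex.I by
      push_cast; ring, Complex.norm_exp_ofReal_mul_I, mul_one]
  · exact hint.norm.hasFiniteIntegral

end Phase

end NablaExpansion

namespace NablaExpansion

open MeasureTheory

/-! ### Fubini for continuous multilinear maps. -/

section Multilinear

variable {E G : Type*} [NormedAddCommGroup E] [NormedSpace ℂ E] [NormedAddCommGroup G]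
  [NormedSpace ℂ G]

theorem integrable_multilinear {n : ℕ} (Φ : ContinuousMultilinearMap ℂ (fun _ : Fin n => E) G)
    {g : Fin n → ℝ → E} (hc : ∀ i, Continuous (g i)) (hg : ∀ i, Integrable (g i)) :
    Integrable fun ζ : Fin n → ℝ => Φ fun i => g i (ζ i) := by
  have h1 : Integrable fun ζ : Fin n → ℝ => ∏ i, ‖g i (ζ i)‖ :=
    Integrable.fintype_prod (μ := fun _ => volume) fun i => (hg i).norm
  refine (h1.const_mul ‖Φ‖).mono' ?_ (.of_forall fun ζ => Φ.le_opNorm _)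
  exact (Φ.cont.comp (continuous_pi fun i => (hc i).comp (continuous_apply i))).aestronglyMeasurable

/-- Induction by currying off the first variable: linearity in that variable moves its integral
outside, and Fubini joins it to the remaining ones. -/
theorem multilinear_integral [CompleteSpace E] [CompleteSpace G] {n : ℕ}
    (Φ : ContinuousMultilinearMap ℂ (fun _ : Fin n => E) G)
    {g : Fin n → ℝ → E} (hc : ∀ i, Continuous (g i)) (hg : ∀ i, Integrable (g i)) :
    Φ (fun i => ∫ t, g i t) = ∫ ζ : Fin n → ℝ, Φ fun i => g i (ζ i) := by
  induction n with
  | zero =>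
    rw [volume_pi, Measure.pi_of_empty _ default, integral_dirac]
    congr 1
    exact Subsingleton.elim _ _
  | succ n ih =>
    have h1 := ih (Φ.curryLeft (∫ t, g 0 t)) (fun i => hc i.succ) (fun i => hg i.succ)
    have h2 : Φ.curryLeft (∫ t, g 0 t) (fun i => ∫ t, g i.succ t) = Φ (fun i => ∫ t, g i t) := by
      rw [ContinuousMultilinearMap.curryLeft_apply]
      congr 1
      funext i
      refine Fin.cases ?_ (fun j => ?_) i <;> simp
    have h3 : ∀ ζ : Fin n → ℝ, Φ.curryLeft (∫ t, g 0 t) (fun i => g i.succ (ζ i))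
        = ∫ t, Φ (Fin.cons (g 0 t) fun i => g i.succ (ζ i)) := by
      intro ζ
      have h := ContinuousLinearMap.integral_comp_comm
        (Φ.toContinuousLinearMap (Fin.cons 0 fun i => g i.succ (ζ i)) 0) (hg 0)
      simp only [ContinuousMultilinearMap.toContinuousLinearMap_apply, Fin.update_cons_zero] at h
      rw [ContinuousMultilinearMap.curryLeft_apply, h]
    have hmp := (volume_preserving_piFinSuccAbove (fun _ : Fin (n + 1) => ℝ) 0).symm
    have hint := integrable_multilinear Φ hc hg
    have h4 := hmp.integral_comp' (g := fun ζ => Φ fun i => g i (ζ i))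
    have h5 := (hmp.integrable_comp_emb (MeasurableEquiv.measurableEmbedding _)).2 hint
    have h6 : ∀ p : ℝ × (Fin n → ℝ),
        (fun i => g i ((MeasurableEquiv.piFinSuccAbove (fun _ : Fin (n + 1) => ℝ) 0).symm p i))
          = (Fin.cons (g 0 p.1) fun i => g i.succ (p.2 i) : Fin (n + 1) → E) := by
      intro p
      funext i
      refine Fin.cases ?_ (fun j => ?_) i <;>
        simp [MeasurableEquiv.piFinSuccAbove, Fin.insertNthEquiv]
    simp only [Function.comp_def, h6] at h4 h5
    rw [← h2, h1, ← h4]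
    simp_rw [h3]
    exact (integral_prod_symm _ h5).symm

end Multilinear

end NablaExpansion

namespace NablaExpansion

open MeasureTheory

/-! ### Locality of the calculus at the joint spectrum. -/

section Locality

theorem norm_cexp_two_pi_I_mul (x : ℝ) : ‖Complex.exp (2 * Real.pi * Complex.I * x)‖ = 1 := by
  rw [show 2 * Real.pi * Complex.I * x = ((2 * Real.pi * x : ℝ) : ℂ) * Complex.I by
    push_cast; ring, Complex.norm_exp_ofReal_mul_I]

theorem fourier_one (φ : 𝓢(ℝ, ℂ)) (ζ : ℝ) :
    𝓕 φ ζ = ∫ x, φ x * Complex.exp (2 * Real.pi * Complex.I * (-(x * ζ) : ℝ)) := by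
  rw [SchwartzMap.fourier_coe, Real.fourier_eq']
  refine integral_congr_ae (.of_forall fun x => ?_)
  simp only [smul_eq_mul, RCLike.inner_apply, conj_trivial]
  rw [mul_comm]
  congr 2
  push_cast; ring

variable {n : ℕ}

/-- The successive differences of a tuple. -/
def diffs (x : Fin (n + 1) → ℝ) : EuclideanSpace ℝ (Fin n) :=
  WithLp.toLp 2 fun j => -x j.castSucc + x j.succ

theorem continuous_diffs : Continuous (diffs : (Fin (n + 1) → ℝ) → EuclideanSpace ℝ (Fin n)) :=
  (PiLp.continuous_toLp 2 _).comp (by fun_prop)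

theorem sum_slotExponent_mul (ξ : Fin n → ℝ) (x : Fin (n + 1) → ℝ) :
    ∑ i, slotExponent ξ i * x i = ∑ j, ξ j * diffs x j := by
  have h := sum_slotExponent_smul ξ (fun i => (x i : ℂ))
  simp only [smul_eq_mul] at h
  exact_mod_cast h

/-- `exp (2πi ⟨y, ξ⟩)`. -/
def wave (ξ y : EuclideanSpace ℝ (Fin n)) : ℂ :=
  Complex.exp (2 * Real.pi * Complex.I * (∑ j, ξ j * y j : ℝ))

theorem norm_wave (ξ y : EuclideanSpace ℝ (Fin n)) : ‖wave ξ y‖ = 1 := norm_cexp_two_pi_I_mul _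

theorem continuous_wave :
    Continuous fun p : EuclideanSpace ℝ (Fin n) × EuclideanSpace ℝ (Fin n) => wave p.1 p.2 := by
  unfold wave; fun_prop

/-- `∏ᵢ φ(xᵢ) exp (-2πi xᵢ ζᵢ)`. -/
def cutoffWave (φ : 𝓢(ℝ, ℂ)) (ζ x : Fin (n + 1) → ℝ) : ℂ :=
  ∏ i, φ (x i) * Complex.exp (2 * Real.pi * Complex.I * (-(x i * ζ i) : ℝ))

theorem integrable_cutoffWave (φ : 𝓢(ℝ, ℂ)) (ζ : Fin (n + 1) → ℝ) :
    Integrable (cutoffWave φ ζ) := by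
  refine Integrable.fintype_prod (μ := fun _ => volume) (f := fun i t => φ t *
    Complex.exp (2 * Real.pi * Complex.I * (-(t * ζ i) : ℝ))) fun i => ?_
  refine φ.integrable.mono ?_ (.of_forall fun t => ?_)
  · have := φ.continuous
    exact Continuous.aestronglyMeasurable (by fun_prop)
  · rw [norm_mul, norm_cexp_two_pi_I_mul, mul_one]

/-- Translating a Fourier transform is modulating the function. The product of the modulations is a
function of the differences alone, since `∑ slotExponent ξ i * x i = ⟨ξ, diffs x⟩`. -/
theorem prod_fourier_sub (φ : 𝓢(ℝ, ℂ)) (ζ : Fin (n + 1) → ℝ) (ξ : EuclideanSpace ℝ (Fin n)) :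
    ∏ i, 𝓕 φ (ζ i - slotExponent ξ.ofLp i) = ∫ x, cutoffWave φ ζ x * wave ξ (diffs x) := by
  simp_rw [fourier_one]
  rw [← integral_fintype_prod_eq_prod (fun i (t : ℝ) => φ t * Complex.exp
    (2 * Real.pi * Complex.I * (-(t * (ζ i - slotExponent ξ.ofLp i)) : ℝ)))]
  refine integral_congr_ae (.of_forall fun x => ?_)
  simp only [cutoffWave, wave, ← sum_slotExponent_mul, Finset.prod_mul_distrib, mul_assoc,
    ← Complex.exp_sum, ← Complex.exp_add]
  congr 2
  push_cast
  simp only [Finset.mul_sum, ← Finset.sum_add_distrib]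
  refine Finset.sum_congr rfl fun i _ => ?_
  ring

variable {A : Type*} [CStarAlgebra A] {W : Type*} [MeasurableSpace W]
  {μ : Measure W} [SFinite μ]

theorem integral_mul_prod_fourier {c : W → ℂ} (hc : Integrable c μ)
    {l : W → EuclideanSpace ℝ (Fin n)} (hl : Measurable l) (φ : 𝓢(ℝ, ℂ)) (ζ : Fin (n + 1) → ℝ) :
    ∫ w, c w * ∏ i, 𝓕 φ (ζ i - slotExponent (l w).ofLp i) ∂μ
      = ∫ x, cutoffWave φ ζ x * ∫ w, c w * wave (l w) (diffs x) ∂μ := by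
  have hint : Integrable (fun p : W × (Fin (n + 1) → ℝ) =>
      c p.1 * cutoffWave φ ζ p.2 * wave (l p.1) (diffs p.2)) (μ.prod volume) := by
    have h := hc.mul_prod (integrable_cutoffWave φ ζ)
    refine h.mono (h.aestronglyMeasurable.mul (Measurable.aestronglyMeasurable ?_))
      (.of_forall fun p => ?_)
    · exact continuous_wave.measurable.comp ((hl.comp measurable_fst).prodMk
        (continuous_diffs.measurable.comp measurable_snd))
    · rw [norm_mul _ (wave _ _), norm_wave, mul_one]
  simp_rw [prod_fourier_sub, ← integral_const_mul, ← mul_assoc]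
  rw [integral_integral_swap hint]
  refine integral_congr_ae (.of_forall fun x => integral_congr_ae (.of_forall fun w => ?_))
  simp only
  ring

theorem phases_eq_integral {a : A} (ha : IsSelfAdjoint a) (φ : 𝓢(ℝ, ℂ))
    (hφ : ∀ x ∈ spectrum ℝ a, φ x = 1) (η : Fin (n + 1) → ℝ) :
    elem (fun i => phase a (η i))
      = ∫ ζ : Fin (n + 1) → ℝ, (∏ i, 𝓕 φ (ζ i - η i)) • elem fun i => phase a (ζ i) := by
  have hcont : ∀ i, Continuous fun t => 𝓕 φ (t - η i) • phase a t := fun i =>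
    ((𝓕 φ).continuous.comp (continuous_id.sub continuous_const)).smul (continuous_phase a)
  have hint : ∀ i, Integrable fun t => 𝓕 φ (t - η i) • phase a t := by
    intro i
    refine ((𝓕 φ).integrable.comp_sub_right (η i)).norm.mono' (hcont i).aestronglyMeasurable
      (.of_forall fun t => ?_)
    rw [norm_smul]
    exact mul_le_of_le_one_right (norm_nonneg _) (norm_phase_le ha t)
  have h := multilinear_integral (elemL A n) hcont hint
  simp only [← phase_eq_integral ha φ hφ] at h
  rw [elemL_apply] at h
  rw [h]
  refine integral_congr_ae (.of_forall fun ζ => ?_)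
  simp only
  rw [(elemL A n).map_smul_univ, elemL_apply]

theorem norm_elem_le (u : Fin (n + 1) → A) : ‖elem u‖ ≤ ∏ i, ‖u i‖ := by
  rw [elem, UniformSpace.Completion.norm_coe]
  exact PiTensorProduct.projectiveSeminorm_tprod_le _

theorem norm_elem_phase_le {a : A} (ha : IsSelfAdjoint a) (η : Fin (n + 1) → ℝ) :
    ‖elem fun i => phase a (η i)‖ ≤ 1 :=
  (norm_elem_le _).trans (Finset.prod_le_one (fun _ _ => norm_nonneg _)
    fun i _ => norm_phase_le ha (η i))

theorem continuous_elem_phase (a : A) :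
    Continuous fun η : Fin (n + 1) → ℝ => elem fun i => phase a (η i) := by
  simp_rw [← elemL_apply]
  exact (elemL A n).cont.comp
    (continuous_pi fun i => (continuous_phase a).comp (continuous_apply i))

/-- With a cutoff in every slot, Fubini moves the data `c`, `l` into a scalar coefficient. They
survive only as the function `y ↦ ∫ c * wave (l w) y`, sampled at `diffs x` where the cutoffs are
nonzero. -/
theorem integral_smul_elem_phase {a : A} (ha : IsSelfAdjoint a) {c : W → ℂ} (hc : Integrable c μ)
    {l : W → EuclideanSpace ℝ (Fin n)} (hl : Measurable l) (φ : 𝓢(ℝ, ℂ))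
    (hφ : ∀ x ∈ spectrum ℝ a, φ x = 1) :
    ∫ w, c w • elem (fun i => phase a (slotExponent (l w).ofLp i)) ∂μ
      = ∫ ζ : Fin (n + 1) → ℝ, (∫ x, cutoffWave φ ζ x * ∫ w, c w * wave (l w) (diffs x) ∂μ) •
          elem fun i => phase a (ζ i) := by
  have hη : Measurable fun w => slotExponent (l w).ofLp :=
    continuous_slotExponent.measurable.comp ((PiLp.continuous_ofLp 2 _).measurable.comp hl)
  set K : (Fin (n + 1) → ℝ) → ℂ := fun ζ => ∏ i, 𝓕 φ (ζ i) with hK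
  have hKi : Integrable K := Integrable.fintype_prod (μ := fun _ => volume) fun i => (𝓕 φ).integrable
  have hKc : Continuous K :=
    continuous_finsetProd _ fun i _ => (𝓕 φ).continuous.comp (continuous_apply i)
  have hmeas : AEStronglyMeasurable (fun p : W × (Fin (n + 1) → ℝ) =>
      c p.1 * K (p.2 - slotExponent (l p.1).ofLp)) (μ.prod volume) := by
    refine hc.aestronglyMeasurable.comp_fst.mul (Measurable.aestronglyMeasurable ?_)
    exact hKc.measurable.comp (measurable_snd.sub (hη.comp measurable_fst))
  have hint0 : Integrable (fun p : W × (Fin (n + 1) → ℝ) =>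
      c p.1 * K (p.2 - slotExponent (l p.1).ofLp)) (μ.prod volume) := by
    rw [integrable_prod_iff hmeas]
    have h0 : ∀ w, Integrable fun ζ => K (ζ - slotExponent (l w).ofLp) := fun w =>
      hKi.comp_sub_right _
    refine ⟨.of_forall fun w => (h0 w).const_mul (c w), ?_⟩
    have h1 : ∀ w, ∫ ζ, ‖c w * K (ζ - slotExponent (l w).ofLp)‖ = ‖c w‖ * ∫ ζ, ‖K ζ‖ := by
      intro w
      simp_rw [norm_mul]
      rw [integral_const_mul, integral_sub_right_eq_self (fun ζ => ‖K ζ‖)]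
    simp_rw [h1]
    exact hc.norm.mul_const _
  have hint : Integrable (fun p : W × (Fin (n + 1) → ℝ) =>
      (c p.1 * K (p.2 - slotExponent (l p.1).ofLp)) • elem fun i => phase a (p.2 i))
      (μ.prod volume) := by
    refine hint0.norm.mono' (hmeas.smul ?_) (.of_forall fun p => ?_)
    · exact ((continuous_elem_phase a).aestronglyMeasurable (μ := volume)).comp_snd
    · rw [norm_smul]
      exact mul_le_of_le_one_right (norm_nonneg _) (norm_elem_phase_le ha _)
  have h2 : ∀ w, c w • elem (fun i => phase a (slotExponent (l w).ofLp i))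
      = ∫ ζ : Fin (n + 1) → ℝ, (c w * K (ζ - slotExponent (l w).ofLp)) •
          elem fun i => phase a (ζ i) := by
    intro w
    rw [phases_eq_integral ha φ hφ, ← integral_smul]
    simp only [smul_smul, hK, Pi.sub_apply]
  simp_rw [h2]
  rw [integral_integral_swap hint]
  refine integral_congr_ae (.of_forall fun ζ => ?_)
  simp only
  rw [integral_smul_const, ← integral_mul_prod_fourier hc hl]
  simp only [hK, Pi.sub_apply]

theorem exists_cutoff {K : Set ℝ} (hK : IsCompact K) {δ : ℝ} (hδ : 0 < δ) :
    ∃ φ : 𝓢(ℝ, ℂ), (∀ x ∈ K, φ x = 1) ∧ ∀ x, φ x ≠ 0 → x ∈ Metric.thickening δ K := by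
  obtain ⟨f, hf0, hf1, -⟩ := exists_contMDiffMap_zero_one_of_isClosed (n := ⊤)
    (modelWithCornersSelf ℝ ℝ)
    (s := (Metric.thickening δ K)ᶜ) (t := K) Metric.isOpen_thickening.isClosed_compl hK.isClosed
    (Set.disjoint_compl_left_iff_subset.2 (Metric.self_subset_thickening hδ K))
  have hz : ∀ x, x ∉ Metric.thickening δ K → f x = 0 := fun x hx => hf0 hx
  have hcs : HasCompactSupport fun x => (f x : ℂ) := by
    refine HasCompactSupport.intro (hK.isBounded.thickening (δ := δ)).isCompact_closure
      fun x hx => ?_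
    rw [hz x fun h => hx (subset_closure h), Complex.ofReal_zero]
  have hsm : ContDiff ℝ ((⊤ : ℕ∞) : WithTop ℕ∞) fun x => (f x : ℂ) :=
    Complex.ofRealCLM.contDiff.comp f.contMDiff.contDiff
  refine ⟨hcs.toSchwartzMap hsm, fun x hx => ?_, fun x hx => ?_⟩
  · change ((f x : ℝ) : ℂ) = 1
    rw [hf1 hx]; simp
  · by_contra h
    exact hx (show ((f x : ℝ) : ℂ) = 0 by rw [hz x h, Complex.ofReal_zero])

theorem isCompact_nablaSpectrum (a : A) (n : ℕ) : IsCompact (nablaSpectrum a n) := by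
  have h : nablaSpectrum a n = diffs '' (Set.univ.pi fun _ => spectrum ℝ a) := by
    ext y
    constructor
    · rintro ⟨x, hx, hy⟩
      exact ⟨x, fun j _ => hx j, by ext j; exact (hy j).symm⟩
    · rintro ⟨x, hx, rfl⟩
      exact ⟨x, fun j => hx j trivial, fun j => rfl⟩
  rw [h]
  exact (isCompact_univ_pi fun _ => spectrum.isCompact a).image continuous_diffs

/-- Two superpositions of the exponentials of `∇ₐ⁽¹⁾, …, ∇ₐ⁽ⁿ⁾` agree as soon as the
corresponding superpositions of plane waves agree near the joint spectrum. -/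
theorem integral_elem_congr {a : A} (ha : IsSelfAdjoint a) {W' : Type*} [MeasurableSpace W']
    {μ' : Measure W'} [SFinite μ'] {c : W → ℂ} (hc : Integrable c μ)
    {l : W → EuclideanSpace ℝ (Fin n)} (hl : Measurable l) {c' : W' → ℂ} (hc' : Integrable c' μ')
    {l' : W' → EuclideanSpace ℝ (Fin n)} (hl' : Measurable l')
    (h : ∀ᶠ y in 𝓝ˢ (nablaSpectrum a n),
      ∫ w, c w * wave (l w) y ∂μ = ∫ w, c' w * wave (l' w) y ∂μ') :
    ∫ w, c w • elem (fun i => phase a (slotExponent (l w).ofLp i)) ∂μ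
      = ∫ w, c' w • elem (fun i => phase a (slotExponent (l' w).ofLp i)) ∂μ' := by
  obtain ⟨V, hV, hsV, hVe⟩ := eventually_nhdsSet_iff_exists.1 h
  have hK : IsCompact (Set.univ.pi fun _ : Fin (n + 1) => spectrum ℝ a) :=
    isCompact_univ_pi fun _ => spectrum.isCompact a
  -- In the sup metric on tuples, the thickening of the compact product is controlled coordinate by
  -- coordinate, so a one-variable cutoff supported within `δ` of the spectrum suffices.
  obtain ⟨δ, hδ, hsub⟩ := hK.exists_thickening_subset_open (hV.preimage continuous_diffs) (by
    intro x hx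
    exact hsV ⟨x, fun j => hx j trivial, fun j => rfl⟩)
  obtain ⟨φ, hφ1, hφ⟩ := exists_cutoff (spectrum.isCompact (𝕜 := ℝ) a) hδ
  rw [integral_smul_elem_phase ha hc hl φ hφ1, integral_smul_elem_phase ha hc' hl' φ hφ1]
  refine integral_congr_ae (.of_forall fun ζ => ?_)
  simp only
  congr 1
  refine integral_congr_ae (.of_forall fun x => ?_)
  simp only
  -- Either every coordinate is `δ`-close to the spectrum and the two wave superpositions agree at
  -- `diffs x`, or one cutoff factor kills both sides.
  by_cases hx : ∀ i, φ (x i) ≠ 0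
  · rw [hVe]
    apply hsub
    have h1 : ∀ i, ∃ z ∈ spectrum ℝ a, dist (x i) z < δ := fun i =>
      Metric.mem_thickening_iff.1 (hφ _ (hx i))
    choose z hz hd using h1
    exact Metric.mem_thickening_iff.2 ⟨z, fun i _ => hz i, (dist_pi_lt_iff hδ).2 hd⟩
  · push Not at hx
    obtain ⟨i, hi⟩ := hx
    have : cutoffWave φ ζ x = 0 := Finset.prod_eq_zero (Finset.mem_univ i) (by rw [hi, zero_mul])
    rw [this, zero_mul, zero_mul]

end Locality

end NablaExpansion

namespace NablaExpansion

open MeasureTheory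

/-! ### The calculus on averages of functions of linear forms. -/

section Calculus

variable {n : ℕ} {T : Type*} [MeasurableSpace T] {ν : Measure T} [IsFiniteMeasure ν]

theorem fourierInversion_euclidean (g : 𝓢(EuclideanSpace ℝ (Fin n), ℂ))
    (y : EuclideanSpace ℝ (Fin n)) : ∫ ξ, 𝓕 g ξ * wave ξ y = g y := by
  have h0 : 𝓕⁻ (𝓕 g : 𝓢(EuclideanSpace ℝ (Fin n), ℂ)) = g :=
    FourierTransform.fourierInv_fourier_eq g
  have h := congrArg (fun g : 𝓢(EuclideanSpace ℝ (Fin n), ℂ) => g y) h0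
  simp only [SchwartzMap.fourierInv_coe, Real.fourierInv_eq'] at h
  rw [← h]
  refine integral_congr_ae (.of_forall fun ξ => ?_)
  simp only [smul_eq_mul, PiLp.inner_apply, RCLike.inner_apply, conj_trivial, wave]
  rw [mul_comm]
  congr 2
  push_cast
  rw [Finset.sum_congr rfl fun j _ => mul_comm (y.ofLp j : ℂ) (ξ.ofLp j : ℂ)]
  ring

theorem integral_fourier_mul_wave (h : 𝓢(ℝ, ℂ)) (v y : EuclideanSpace ℝ (Fin n)) :
    ∫ s : ℝ, 𝓕 h s * wave (s • v) y = h (∑ j, v j * y j) := by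
  rw [← fourierInversion_one]
  refine integral_congr_ae (.of_forall fun s => ?_)
  simp only [wave, PiLp.smul_apply, smul_eq_mul, mul_assoc, ← Finset.mul_sum]
  push_cast
  ring_nf

theorem integral_prod_fourier_mul_wave (h : 𝓢(ℝ, ℂ)) {v : T → EuclideanSpace ℝ (Fin n)}
    (hv : Measurable v) (y : EuclideanSpace ℝ (Fin n)) :
    ∫ p : T × ℝ, 𝓕 h p.2 * wave (p.2 • v p.1) y ∂(ν.prod volume)
      = ∫ t, h (∑ j, v t j * y j) ∂ν := by
  rw [integral_prod]
  · simp_rw [integral_fourier_mul_wave]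
  · have h1 : Integrable (fun p : T × ℝ => 𝓕 h p.2) (ν.prod volume) :=
      (𝓕 h).integrable.comp_snd ν
    have h2 : Measurable fun p : T × ℝ => p.2 • v p.1 :=
      measurable_snd.smul (hv.comp measurable_fst)
    have h4 : Continuous fun ξ : EuclideanSpace ℝ (Fin n) => wave ξ y := by unfold wave; fun_prop
    have h3 : Measurable fun p : T × ℝ => wave (p.2 • v p.1) y := h4.measurable.comp h2
    refine h1.mono (h1.aestronglyMeasurable.mul h3.aestronglyMeasurable) (.of_forall fun p => ?_)
    · rw [norm_mul, norm_wave, mul_one]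

/-- The function is the Fourier integral of a density against a pushed-forward measure. All moments
are finite, as `𝓕 h` decays rapidly and `v` is essentially bounded, so differentiation under the
integral is allowed to every order. -/
theorem contDiff_integral_comp_linear (h : 𝓢(ℝ, ℂ)) {v : T → EuclideanSpace ℝ (Fin n)}
    (hv : Measurable v) {M : ℝ} (hM : ∀ᵐ t ∂ν, ‖v t‖ ≤ M) :
    ContDiff ℝ ((⊤ : ℕ∞) : WithTop ℕ∞) fun y : EuclideanSpace ℝ (Fin n) =>
      ∫ t, h (∑ j, v t j * y j) ∂ν := by
  -- The coordinate `s` is kept beside the frequency `s v_t` so that `𝓕 h s` remains a function on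
  -- the target space.
  let m : T × ℝ → ℝ × EuclideanSpace ℝ (Fin n) := fun p => (p.2, p.2 • v p.1)
  have hm : Measurable m := measurable_snd.prodMk (measurable_snd.smul (hv.comp measurable_fst))
  -- The sign cancels the minus in the kernel of `VectorFourier.fourierIntegral`.
  let B : ℝ × EuclideanSpace ℝ (Fin n) →L[ℝ] EuclideanSpace ℝ (Fin n) →L[ℝ] ℝ :=
    (-(innerSL ℝ)).comp (ContinuousLinearMap.snd ℝ ℝ (EuclideanSpace ℝ (Fin n)))
  let f : ℝ × EuclideanSpace ℝ (Fin n) → ℂ := fun q => 𝓕 h q.1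
  have hf : Continuous f := (𝓕 h).continuous.comp continuous_fst
  have hmom : ∀ k : ℕ, (k : ℕ∞) ≤ ⊤ →
      Integrable (fun q => ‖q‖ ^ k * ‖f q‖) ((ν.prod volume).map m) := by
    intro k _
    have hc : Continuous fun q => ‖q‖ ^ k * ‖f q‖ := by fun_prop
    rw [integrable_map_measure hc.aestronglyMeasurable hm.aemeasurable]
    have h1 : Integrable (fun p : T × ℝ => max 1 M ^ k * (‖p.2‖ ^ k * ‖𝓕 h p.2‖))
        (ν.prod volume) := (((𝓕 h).integrable_pow_mul volume k).comp_snd ν).const_mul _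
    refine h1.mono' (hc.measurable.comp hm).aestronglyMeasurable ?_
    have hM' : ∀ᵐ p ∂(ν.prod (volume : Measure ℝ)), ‖v p.1‖ ≤ M :=
      Measure.quasiMeasurePreserving_fst.ae hM
    filter_upwards [hM'] with p hp
    have h2 : ‖m p‖ ≤ max 1 M * ‖p.2‖ := by
      refine max_le ?_ ?_
      · exact le_mul_of_one_le_left (norm_nonneg _) (le_max_left _ _)
      · change ‖p.2 • v p.1‖ ≤ _
        rw [norm_smul, mul_comm]
        gcongr
        exact hp.trans (le_max_right _ _)
    simp only [Function.comp_apply, norm_mul, norm_pow, norm_norm]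
    rw [← mul_assoc, ← mul_pow]
    gcongr
  have key := VectorFourier.contDiff_fourierIntegral B hmom
  suffices heq : (fun y : EuclideanSpace ℝ (Fin n) => ∫ t, h (∑ j, v t j * y j) ∂ν)
      = VectorFourier.fourierIntegral Real.fourierChar ((ν.prod volume).map m)
        (ContinuousLinearMap.toLinearMap₁₂ B) f by
    rw [heq]; exact key
  funext y
  rw [← integral_prod_fourier_mul_wave h hv y]
  unfold VectorFourier.fourierIntegral
  rw [integral_map hm.aemeasurable]
  · refine integral_congr_ae (.of_forall fun p => ?_)
    simp only [f, m, B, wave, Circle.smul_def, Real.fourierChar_apply, smul_eq_mul]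
    rw [mul_comm]
    congr 2
    simp [PiLp.inner_apply]
    simp only [Finset.mul_sum, Finset.sum_mul]
    refine Finset.sum_congr rfl fun j _ => ?_
    ring
  · refine Continuous.aestronglyMeasurable ?_
    refine Continuous.smul ?_ hf
    refine (by fun_prop : Continuous ((↑) : Circle → ℂ)).comp
      (Real.continuous_fourierChar.comp ?_)
    exact (((ContinuousLinearMap.apply ℝ ℝ y).comp B).continuous).neg

theorem exists_schwartz_eventuallyEq {K : Set (EuclideanSpace ℝ (Fin n))} (hK : IsCompact K)
    {F : EuclideanSpace ℝ (Fin n) → ℂ} (hF : ContDiff ℝ ((⊤ : ℕ∞) : WithTop ℕ∞) F) :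
    ∃ g : 𝓢(EuclideanSpace ℝ (Fin n), ℂ), ∀ᶠ y in 𝓝ˢ K, g y = F y := by
  obtain ⟨R, hR, hKR⟩ := hK.isBounded.subset_ball_lt 0 0
  let χ : ContDiffBump (0 : EuclideanSpace ℝ (Fin n)) := ⟨R, R + 1, hR, lt_add_one R⟩
  have hs : ContDiff ℝ ((⊤ : ℕ∞) : WithTop ℕ∞) fun y => χ y • F y := χ.contDiff.smul hF
  have hc : HasCompactSupport fun y => χ y • F y := χ.hasCompactSupport.smul_right
  refine ⟨hc.toSchwartzMap hs, ?_⟩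
  refine eventually_nhdsSet_iff_exists.2 ⟨Metric.ball 0 R, Metric.isOpen_ball, hKR, fun y hy => ?_⟩
  change χ y • F y = F y
  rw [χ.one_of_mem_closedBall (Metric.ball_subset_closedBall hy), one_smul]

variable {A : Type*} [CStarAlgebra A]

/-- Smoothness and compactness of the joint spectrum ensure that the definition takes its nontrivial
branch. The chosen Schwartz function and the explicit wave superposition then agree near the joint
spectrum, and locality identifies their images. -/
theorem nablaCalc_integral_comp_linear {a : A} (ha : IsSelfAdjoint a) (h : 𝓢(ℝ, ℂ))
    {v : T → EuclideanSpace ℝ (Fin n)} (hv : Measurable v) {M : ℝ} (hM : ∀ᵐ t ∂ν, ‖v t‖ ≤ M) :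
    nablaCalc a (fun y => ∫ t, h (∑ j, v t j * y j) ∂ν)
      = ∫ p : T × ℝ, 𝓕 h p.2 • elem (fun i => phase a (slotExponent (p.2 • v p.1).ofLp i))
          ∂(ν.prod volume) := by
  have hex := exists_schwartz_eventuallyEq (isCompact_nablaSpectrum a n)
    (contDiff_integral_comp_linear h hv hM)
  rw [nablaCalc, dif_pos hex]
  have hg := hex.choose_spec
  set g := hex.choose
  rw [schwartzCalc]
  simp_rw [exp_nabla]
  refine integral_elem_congr (l := id) (l' := fun p : T × ℝ => p.2 • v p.1) ha (𝓕 g).integrable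
    measurable_id ((𝓕 h).integrable.comp_snd ν)
    (measurable_snd.smul (hv.comp measurable_fst)) ?_
  filter_upwards [hg] with y hy
  rw [integral_prod_fourier_mul_wave h hv y, ← hy]
  exact fourierInversion_euclidean g y

theorem integrable_smul_elem_phase {a : A} (ha : IsSelfAdjoint a) (h : 𝓢(ℝ, ℂ))
    {v : T → EuclideanSpace ℝ (Fin n)} (hv : Measurable v) :
    Integrable (fun p : T × ℝ => 𝓕 h p.2 •
      elem (fun i => phase a (slotExponent (p.2 • v p.1).ofLp i))) (ν.prod volume) := by
  have h1 : Integrable (fun p : T × ℝ => 𝓕 h p.2) (ν.prod volume) := (𝓕 h).integrable.comp_snd ν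
  have h2 : Measurable fun p : T × ℝ => (p.2 • v p.1).ofLp :=
    (PiLp.continuous_ofLp 2 _).measurable.comp (measurable_snd.smul (hv.comp measurable_fst))
  have h3 : StronglyMeasurable fun η : Fin n → ℝ =>
      elem fun i => phase a (slotExponent η i) :=
    ((continuous_elem_phase a).comp continuous_slotExponent).stronglyMeasurable
  refine h1.norm.mono' (h1.aestronglyMeasurable.smul
    (h3.comp_measurable h2).aestronglyMeasurable) (.of_forall fun p => ?_)
  rw [norm_smul]
  exact mul_le_of_le_one_right (norm_nonneg _) (norm_elem_phase_le ha _)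

theorem contract_nablaCalc_integral {a : A} (ha : IsSelfAdjoint a) (h : 𝓢(ℝ, ℂ))
    {v : T → EuclideanSpace ℝ (Fin n)} (hv : Measurable v) {M : ℝ} (hM : ∀ᵐ t ∂ν, ‖v t‖ ≤ M)
    (b : Fin n → A) :
    contract (nablaCalc a (fun y => ∫ t, h (∑ j, v t j * y j) ∂ν)) b
      = ∫ s : ℝ, 𝓕 h s • ∫ t,
          contract (elem fun i => phase a (slotExponent (s • v t).ofLp i)) b ∂ν := by
  have hint := integrable_smul_elem_phase (ν := ν) ha h hv
  rw [nablaCalc_integral_comp_linear ha h hv hM, ← contractL_apply,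
    ← ContinuousLinearMap.integral_comp_comm _ hint,
    integral_prod_symm _ ((contractL b).integrable_comp hint)]
  simp_rw [map_smul, contractL_apply, integral_smul]

end Calculus

end NablaExpansion

namespace NablaExpansion

open MeasureTheory

/-! ### Integrals over low-dimensional simplices. -/

section Simplex

/-- The simplex over which `dividedDiff` integrates. -/
def simplex (m : ℕ) : Set (Fin m → ℝ) := {s | (∀ j, 0 ≤ s j) ∧ ∑ j, s j ≤ 1}

theorem isClosed_simplex (m : ℕ) : IsClosed (simplex m) := by
  have h : simplex m = (⋂ j, {s | 0 ≤ s j}) ∩ {s | ∑ j, s j ≤ 1} := by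
    ext s; simp [simplex]
  rw [h]
  exact (isClosed_iInter fun j => isClosed_le continuous_const (continuous_apply j)).inter
    (isClosed_le (by fun_prop) continuous_const)

theorem isCompact_simplex (m : ℕ) : IsCompact (simplex m) := by
  refine isCompact_Icc.of_isClosed_subset (isClosed_simplex m)
    (fun s hs => ⟨fun j => hs.1 j, fun j => ?_⟩ : simplex m ⊆ Set.Icc 0 1)
  exact (Finset.single_le_sum (fun i _ => hs.1 i) (Finset.mem_univ j)).trans hs.2

instance isFiniteMeasure_simplex (m : ℕ) :
    IsFiniteMeasure ((volume : Measure (Fin m → ℝ)).restrict (simplex m)) :=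
  ⟨by rw [Measure.restrict_apply_univ]; exact (isCompact_simplex m).measure_lt_top⟩

variable {E : Type*} [NormedAddCommGroup E] [NormedSpace ℝ E]

theorem integral_simplex_zero [CompleteSpace E] (G : (Fin 0 → ℝ) → E) : ∫ s in simplex 0, G s = G ![] := by
  have h : simplex 0 = Set.univ := by ext s; simp [simplex]
  rw [h, Measure.restrict_univ, volume_pi, Measure.pi_of_empty _ ![], integral_dirac]

theorem integral_simplex_one (G : ℝ → E) :
    ∫ s in simplex 1, G (s 0) = ∫ r in (0 : ℝ)..1, G r := by
  have h : simplex 1 = MeasurableEquiv.funUnique (Fin 1) ℝ ⁻¹' Set.Icc 0 1 := by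
    ext s; simp [simplex]
  rw [h, intervalIntegral.integral_of_le zero_le_one, ← integral_Icc_eq_integral_Ioc]
  exact (volume_preserving_funUnique (Fin 1) ℝ).setIntegral_preimage_emb
    (MeasurableEquiv.measurableEmbedding _) G _

theorem integral_simplex_two {G : ℝ → ℝ → E} (hG : Continuous fun p : ℝ × ℝ => G p.1 p.2) :
    ∫ s in simplex 2, G (s 0) (s 1)
      = ∫ r₁ in (0 : ℝ)..1, ∫ r₀ in (0 : ℝ)..(1 - r₁), G r₀ r₁ := by
  let S : Set (ℝ × ℝ) := {p | (0 ≤ p.1 ∧ 0 ≤ p.2) ∧ p.1 + p.2 ≤ 1}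
  have h : simplex 2 = MeasurableEquiv.finTwoArrow ⁻¹' S := by
    ext s; simp [simplex, S, Fin.forall_fin_two]
  have hSc : IsClosed S :=
    ((isClosed_le continuous_const continuous_fst).inter
      (isClosed_le continuous_const continuous_snd)).inter
      (isClosed_le (continuous_fst.add continuous_snd) continuous_const)
  have hS : IsCompact S := by
    refine (isCompact_Icc (a := ((0 : ℝ), (0 : ℝ))) (b := (1, 1))).of_isClosed_subset hSc ?_
    rintro ⟨p, q⟩ ⟨⟨h1, h2⟩, h3⟩
    simp only at h1 h2 h3
    exact ⟨⟨h1, h2⟩, ⟨by simp only; linarith, by simp only; linarith⟩⟩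
  have hmp := (volume_preserving_finTwoArrow ℝ).setIntegral_preimage_emb
    (MeasurableEquiv.measurableEmbedding _) (fun p => G p.1 p.2) S
  rw [h]
  refine Eq.trans hmp ?_
  have hint : Integrable (S.indicator fun p => G p.1 p.2) (volume.prod volume) := by
    rw [integrable_indicator_iff hSc.measurableSet]
    exact hG.continuousOn.integrableOn_compact hS
  rw [← integral_indicator hSc.measurableSet, Measure.volume_eq_prod, integral_prod_symm _ hint,
    intervalIntegral.integral_of_le zero_le_one, ← integral_Icc_eq_integral_Ioc,
    ← integral_indicator measurableSet_Icc]
  refine integral_congr_ae (.of_forall fun r₁ => ?_)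
  simp only
  by_cases hr : r₁ ∈ Set.Icc (0 : ℝ) 1
  · rw [Set.indicator_of_mem hr, intervalIntegral.integral_of_le (by linarith [hr.2]),
      ← integral_Icc_eq_integral_Ioc, ← integral_indicator measurableSet_Icc]
    refine integral_congr_ae (.of_forall fun r₀ => ?_)
    have hiff : (r₀, r₁) ∈ S ↔ r₀ ∈ Set.Icc 0 (1 - r₁) := by
      constructor
      · rintro ⟨⟨h1, h2⟩, h3⟩
        simp only at h1 h2 h3
        exact ⟨h1, by linarith⟩
      · rintro ⟨h1, h2⟩
        exact ⟨⟨h1, hr.1⟩, by simp only; linarith⟩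
    by_cases hm : (r₀, r₁) ∈ S
    · simp only [Set.indicator_of_mem hm, Set.indicator_of_mem (hiff.1 hm)]
    · simp only [Set.indicator_of_notMem hm, Set.indicator_of_notMem fun h => hm (hiff.2 h)]
  · rw [Set.indicator_of_notMem hr]
    refine integral_eq_zero_of_ae (.of_forall fun r₀ => ?_)
    refine Set.indicator_of_notMem ?_ _
    rintro ⟨⟨h1, h2⟩, h3⟩
    simp only at h1 h2 h3
    exact hr ⟨h2, by linarith⟩

theorem integral_triangle_swap {Q : ℝ → ℝ → E} (hQ : Continuous fun p : ℝ × ℝ => Q p.1 p.2) :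
    ∫ w in (0 : ℝ)..1, ∫ u in w..1, Q u w = ∫ u in (0 : ℝ)..1, ∫ w in (0 : ℝ)..u, Q u w := by
  let S : Set (ℝ × ℝ) := {p | (0 ≤ p.2 ∧ p.2 ≤ p.1) ∧ p.1 ≤ 1}
  have hSc : IsClosed S :=
    ((isClosed_le continuous_const continuous_snd).inter
      (isClosed_le continuous_snd continuous_fst)).inter
      (isClosed_le continuous_fst continuous_const)
  have hS : IsCompact S := by
    refine (isCompact_Icc (a := ((0 : ℝ), (0 : ℝ))) (b := (1, 1))).of_isClosed_subset hSc ?_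
    rintro ⟨p, q⟩ ⟨⟨h1, h2⟩, h3⟩
    simp only at h1 h2 h3
    exact ⟨⟨by simp only; linarith, h1⟩, ⟨h3, by simp only; linarith⟩⟩
  have hint : Integrable (Function.uncurry fun u w => S.indicator (fun p => Q p.1 p.2) (u, w))
      (volume.prod volume) := by
    have : Integrable (S.indicator fun p => Q p.1 p.2) (volume.prod volume) := by
      rw [integrable_indicator_iff hSc.measurableSet]
      exact hQ.continuousOn.integrableOn_compact hS
    exact this
  have key (g : ℝ → E) (p q : ℝ) (T : Set ℝ) (hT : ∀ t, t ∈ T ↔ t ∈ Set.Icc p q) (hpq : p ≤ q) :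
      ∫ t in p..q, g t = ∫ t, T.indicator g t := by
    rw [Set.ext hT, integral_indicator measurableSet_Icc, intervalIntegral.integral_of_le hpq,
      integral_Icc_eq_integral_Ioc]
  have e1 : ∫ w in (0 : ℝ)..1, ∫ u in w..1, Q u w
      = ∫ w, ∫ u, S.indicator (fun p => Q p.1 p.2) (u, w) := by
    rw [key _ 0 1 (Set.Icc 0 1) (fun _ => Iff.rfl) zero_le_one]
    refine integral_congr_ae (.of_forall fun w => ?_)
    simp only
    by_cases hw : w ∈ Set.Icc (0 : ℝ) 1
    · rw [Set.indicator_of_mem hw, key _ w 1 {u | (u, w) ∈ S} _ hw.2]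
      · rfl
      · intro u
        exact ⟨fun h => ⟨h.1.2, h.2⟩, fun h => ⟨⟨hw.1, h.1⟩, h.2⟩⟩
    · rw [Set.indicator_of_notMem hw]
      refine (integral_eq_zero_of_ae (.of_forall fun u => Set.indicator_of_notMem ?_ _)).symm
      exact fun h => hw ⟨h.1.1, h.1.2.trans h.2⟩
  have e2 : ∫ u in (0 : ℝ)..1, ∫ w in (0 : ℝ)..u, Q u w
      = ∫ u, ∫ w, S.indicator (fun p => Q p.1 p.2) (u, w) := by
    rw [key _ 0 1 (Set.Icc 0 1) (fun _ => Iff.rfl) zero_le_one]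
    refine integral_congr_ae (.of_forall fun u => ?_)
    simp only
    by_cases hu : u ∈ Set.Icc (0 : ℝ) 1
    · rw [Set.indicator_of_mem hu, key _ 0 u {w | (u, w) ∈ S} _ hu.1]
      · rfl
      · intro w
        exact ⟨fun h => h.1, fun h => ⟨h, hu.2⟩⟩
    · rw [Set.indicator_of_notMem hu]
      refine (integral_eq_zero_of_ae (.of_forall fun w => Set.indicator_of_notMem ?_ _)).symm
      exact fun h => hu ⟨h.1.1.trans h.1.2, h.2⟩
  rw [e1, e2, integral_integral_swap hint]

end Simplex

/-! ### Contracted divided differences as Fourier integrals. -/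

section DividedDiff

theorem exists_schwartz_iteratedDeriv (f : 𝓢(ℝ, ℂ)) (m : ℕ) :
    ∃ h : 𝓢(ℝ, ℂ), (∀ x, h x = iteratedDeriv m f x) ∧
      ∀ s : ℝ, 𝓕 h s = (2 * Real.pi * Complex.I * s) ^ m * 𝓕 f s := by
  induction m with
  | zero => exact ⟨f, by simp⟩
  | succ m ih =>
    obtain ⟨h, h1, h2⟩ := ih
    refine ⟨SchwartzMap.derivCLM ℂ ℂ h, fun x => ?_, fun s => ?_⟩
    · rw [SchwartzMap.derivCLM_apply, iteratedDeriv_succ, funext h1]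
    · have h3 : 𝓕 (SchwartzMap.derivCLM ℂ ℂ h) s = 𝓕 (deriv h) s := rfl
      rw [h3, Real.fourier_deriv h.integrable h.differentiable
        (SchwartzMap.derivCLM ℂ ℂ h).integrable, ← SchwartzMap.fourier_coe]
      simp only [h2, smul_eq_mul]
      ring

theorem slotExponent_smul {n : ℕ} (s : ℝ) (ξ : Fin n → ℝ) (i : Fin (n + 1)) :
    slotExponent (s • ξ) i = s * slotExponent ξ i := by
  have h1 : (Fin.cons 0 (s • ξ) : Fin (n + 1) → ℝ) i = s * (Fin.cons 0 ξ : Fin (n + 1) → ℝ) i := by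
    refine Fin.cases ?_ (fun j => ?_) i <;> simp
  have h2 : (Fin.snoc (s • ξ) 0 : Fin (n + 1) → ℝ) i = s * (Fin.snoc ξ 0 : Fin (n + 1) → ℝ) i := by
    refine Fin.lastCases ?_ (fun j => ?_) i <;> simp
  rw [slotExponent, slotExponent, h1, h2, mul_sub]

variable {A : Type*} [CStarAlgebra A] {n m : ℕ}

/-- Hypothesis `hX` says that the Genocchi–Hermite combination of the nodes is the linear form
`⟨v_t, y⟩`; the factor `(2πis)ᵐ` is the Fourier symbol of the `m`-th derivative. Integrability is
recorded for adding the terms later. -/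
theorem contract_nablaCalc_dividedDiff {a : A} (ha : IsSelfAdjoint a) (f : 𝓢(ℝ, ℂ))
    {v : (Fin m → ℝ) → EuclideanSpace ℝ (Fin n)} (hv : Continuous v)
    {X : EuclideanSpace ℝ (Fin n) → Fin (m + 1) → ℝ}
    (hX : ∀ t y, (1 - ∑ j, t j) * X y 0 + ∑ j, t j * X y j.succ = ∑ j, v t j * y j)
    (b : Fin n → A) :
    Integrable (fun s : ℝ => ((2 * Real.pi * Complex.I * s) ^ m * 𝓕 f s) • ∫ t in simplex m,
      contract (elem fun i => phase a (s * slotExponent (v t).ofLp i)) b) ∧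
    contract (nablaCalc a fun y => dividedDiff f (X y)) b
      = ∫ s : ℝ, ((2 * Real.pi * Complex.I * s) ^ m * 𝓕 f s) • ∫ t in simplex m,
          contract (elem fun i => phase a (s * slotExponent (v t).ofLp i)) b := by
  obtain ⟨h, h1, h2⟩ := exists_schwartz_iteratedDeriv f m
  obtain ⟨M, hM⟩ := (isCompact_simplex m).exists_bound_of_continuousOn hv.continuousOn
  have hF : (fun y => dividedDiff f (X y))
      = fun y => ∫ t in simplex m, h (∑ j, v t j * y j) := by
    funext y
    simp_rw [← hX, h1]
    rfl
  have hM' : ∀ᵐ t ∂((volume : Measure (Fin m → ℝ)).restrict (simplex m)), ‖v t‖ ≤ M :=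
    ae_restrict_of_forall_mem (isClosed_simplex m).measurableSet hM
  have hc := contract_nablaCalc_integral ha h hv.measurable hM' b
  have hi := ((contractL b).integrable_comp (integrable_smul_elem_phase
    (ν := volume.restrict (simplex m)) ha h hv.measurable)).integral_prod_right
  simp only [map_smul, contractL_apply, integral_smul, h2, WithLp.ofLp_smul,
    slotExponent_smul] at hi hc
  rw [hF]
  exact ⟨hi, hc⟩

end DividedDiff

end NablaExpansion

namespace NablaExpansion

open MeasureTheory intervalIntegral

/-! ### Duhamel expansion to third order, with remainder bounds. -/

section Duhamel

variable {A : Type*} [CStarAlgebra A]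

theorem hasDerivAt_phase (c : A) (t : ℝ) :
    HasDerivAt (phase c) ((2 * Real.pi * Complex.I : ℂ) • (phase c t * c)) t := by
  have h := (hasDerivAt_exp_smul_const (𝕂 := ℝ) ((2 * Real.pi * Complex.I : ℂ) • c) t)
  have e : ∀ u : ℝ, u • (2 * Real.pi * Complex.I : ℂ) • c
      = (2 * Real.pi * Complex.I * u : ℂ) • c := by
    intro u
    rw [← Complex.coe_smul u, smul_smul, mul_comm]
  simp only [e, mul_smul_comm] at h
  exact h

theorem commute_phase (c : A) (t : ℝ) : Commute c (phase c t) := by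
  let +nondep : NormedAlgebra ℚ A := .restrictScalars ℚ ℂ A
  exact ((Commute.refl c).smul_right _).exp_right

theorem integral_mul_mul {Y : ℝ → A} {p q : ℝ} (u v : A) (hY : Continuous Y) :
    ∫ r in p..q, u * Y r * v = u * (∫ r in p..q, Y r) * v :=
  (ContinuousLinearMap.mulLeftRight ℝ A u v).intervalIntegral_comp_comm
    (hY.intervalIntegrable p q)

/-- `∫₀¹ exp (2πi t (1-r) a) b exp (2πi t r a) dr`. -/
def duhamelOne (a b : A) (t : ℝ) : A :=
  ∫ r in (0 : ℝ)..1, phase a (t * (1 - r)) * b * phase a (t * r)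

/-- The second iterated Duhamel integral. -/
def duhamelTwo (a b : A) (t : ℝ) : A :=
  ∫ r₁ in (0 : ℝ)..1, ∫ r₀ in (0 : ℝ)..(1 - r₁),
    phase a (t * (1 - (r₀ + r₁))) * b * phase a (t * r₀) * b * phase a (t * r₁)

/-- `exp (2πi t (a+b)) - exp (2πi t a)`. -/
def duhamelRemOne (a b : A) (t : ℝ) : A := phase (a + b) t - phase a t

/-- The remainder of the first-order Duhamel expansion. -/
def duhamelRemTwo (a b : A) (t : ℝ) : A :=
  duhamelRemOne a b t - (2 * Real.pi * Complex.I * t : ℂ) • duhamelOne a b t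

/-- The remainder of the second-order Duhamel expansion. -/
def duhamelRemThree (a b : A) (t : ℝ) : A :=
  duhamelRemTwo a b t - (2 * Real.pi * Complex.I * t : ℂ) ^ 2 • duhamelTwo a b t

/-- Integrate the derivative of `r ↦ e^{2πit(1-r)(a+b)} e^{2πitra}` over `[0, 1]`. Since `a`
commutes with its exponential, only `b` survives between the factors. -/
theorem duhamelRemOne_eq (a b : A) (t : ℝ) : duhamelRemOne a b t
    = (2 * Real.pi * Complex.I * t : ℂ) •
      ∫ r in (0 : ℝ)..1, phase (a + b) (t * (1 - r)) * b * phase a (t * r) := by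
  have hd : ∀ r : ℝ, HasDerivAt (fun r => phase (a + b) (t * (1 - r)) * phase a (t * r))
      (-((2 * Real.pi * Complex.I * t : ℂ) •
        (phase (a + b) (t * (1 - r)) * b * phase a (t * r)))) r := by
    intro r
    have l1 : HasDerivAt (fun r : ℝ => t * (1 - r)) (-t) r := by
      simpa using ((hasDerivAt_id r).const_sub 1).const_mul t
    have l2 : HasDerivAt (fun r : ℝ => t * r) t r := by
      simpa using (hasDerivAt_id r).const_mul t
    have h1 := (hasDerivAt_phase (a + b) (t * (1 - r))).scomp r l1
    have h2 := (hasDerivAt_phase a (t * r)).scomp r l2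
    have h := h1.mul h2
    simp only [Function.comp_def] at h
    refine h.congr_deriv ?_
    rw [← (commute_phase a (t * r)).eq]
    simp only [← Complex.coe_smul, smul_smul, smul_mul_assoc, mul_smul_comm,
      neg_mul, neg_smul, mul_assoc, mul_add, add_mul, smul_add]
    rw [show (t : ℂ) * (2 * (Real.pi * Complex.I)) = 2 * (Real.pi * (Complex.I * t)) by ring]
    abel
  have hP := continuous_phase a
  have hQ := continuous_phase (a + b)
  have h := integral_eq_sub_of_hasDerivAt (a := 0) (b := 1) (fun r _ => hd r)
    (Continuous.intervalIntegrable (by fun_prop) _ _)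
  simp only [sub_self, mul_zero, mul_one, sub_zero, phase_zero, one_mul] at h
  rw [intervalIntegral.integral_neg, intervalIntegral.integral_smul] at h
  rw [duhamelRemOne, ← neg_sub, ← h, neg_neg]

/-- Subtracting `duhamelOne` replaces the perturbed exponential in the first-order formula by its
own remainder. Every remainder thus arises from the previous one by the same integral operator. -/
theorem duhamelRemTwo_eq (a b : A) (t : ℝ) : duhamelRemTwo a b t
    = (2 * Real.pi * Complex.I * t : ℂ) •
      ∫ r in (0 : ℝ)..1, duhamelRemOne a b (t * (1 - r)) * b * phase a (t * r) := by
  have hP := continuous_phase a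
  have hQ := continuous_phase (a + b)
  rw [duhamelRemTwo, duhamelRemOne_eq, duhamelOne, ← smul_sub, ← intervalIntegral.integral_sub
    (Continuous.intervalIntegrable (by fun_prop) _ _)
    (Continuous.intervalIntegrable (by fun_prop) _ _)]
  simp only [duhamelRemOne, sub_mul]

theorem continuous_duhamelOne (a b : A) : Continuous (duhamelOne a b) := by
  have hP := continuous_phase a
  unfold duhamelOne
  exact intervalIntegral.continuous_parametric_intervalIntegral_of_continuous' (by
    unfold Function.uncurry; fun_prop) _ _

theorem duhamelTwo_eq (a b : A) (t : ℝ) : (t : ℂ) • duhamelTwo a b t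
    = ∫ r in (0 : ℝ)..1, ((t * (1 - r) : ℝ) : ℂ) •
        duhamelOne a b (t * (1 - r)) * b * phase a (t * r) := by
  have hP := continuous_phase a
  rw [duhamelTwo, ← intervalIntegral.integral_smul]
  refine intervalIntegral.integral_congr fun r _ => ?_
  -- Rescaling `[0, 1 - r]` to `[0, 1]` produces the factor `1 - r`; kept as a multiplier rather
  -- than divided out, it causes no trouble at `r = 1`.
  have h1 := intervalIntegral.smul_integral_comp_mul_left (a := 0) (b := 1)
    (fun q => phase a (t * (1 - r - q)) * b * phase a (t * q)) (1 - r)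
  rw [mul_zero, mul_one] at h1
  have h2 : ∫ q in (0 : ℝ)..1, (fun q => phase a (t * (1 - r - q)) * b * phase a (t * q))
      ((1 - r) * q) = duhamelOne a b (t * (1 - r)) := by
    rw [duhamelOne]
    refine intervalIntegral.integral_congr fun q _ => ?_
    beta_reduce
    rw [show t * (1 - r) * (1 - q) = t * (1 - r - (1 - r) * q) by ring,
      show t * (1 - r) * q = t * ((1 - r) * q) by ring]
  have h3 : ∫ q in (0 : ℝ)..(1 - r),
      phase a (t * (1 - (q + r))) * b * phase a (t * q) * b * phase a (t * r)
      = (∫ q in (0 : ℝ)..(1 - r), phase a (t * (1 - r - q)) * b * phase a (t * q))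
        * (b * phase a (t * r)) := by
    have h4 := integral_mul_mul (p := 0) (q := 1 - r) 1 (b * phase a (t * r))
      (Y := fun q => phase a (t * (1 - r - q)) * b * phase a (t * q)) (by fun_prop)
    rw [one_mul] at h4
    rw [← h4]
    refine intervalIntegral.integral_congr fun q _ => ?_
    rw [show 1 - (q + r) = 1 - r - q by ring]
    simp only [mul_assoc, one_mul]
  rw [h3, ← h1, h2, Complex.coe_smul, Complex.coe_smul, mul_smul]
  simp only [smul_mul_assoc, mul_assoc]

theorem duhamelRemThree_eq (a b : A) (t : ℝ) : duhamelRemThree a b t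
    = (2 * Real.pi * Complex.I * t : ℂ) •
      ∫ r in (0 : ℝ)..1, duhamelRemTwo a b (t * (1 - r)) * b * phase a (t * r) := by
  have hP := continuous_phase a
  have hQ := continuous_phase (a + b)
  have hD := continuous_duhamelOne a b
  have h2 : (2 * Real.pi * Complex.I * t : ℂ) ^ 2 • duhamelTwo a b t
      = (2 * Real.pi * Complex.I * t : ℂ) • ((2 * Real.pi * Complex.I : ℂ) •
        ((t : ℂ) • duhamelTwo a b t)) := by
    simp only [smul_smul]
    congr 1
    ring
  rw [duhamelRemThree, h2, duhamelRemTwo_eq, duhamelTwo_eq, ← smul_sub,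
    ← intervalIntegral.integral_smul, ← intervalIntegral.integral_sub
    (Continuous.intervalIntegrable (by unfold duhamelRemOne; fun_prop) _ _)
    (Continuous.intervalIntegrable (by fun_prop) _ _)]
  congr 1
  refine intervalIntegral.integral_congr fun r _ => ?_
  simp only [duhamelRemTwo, sub_mul, smul_mul_assoc, smul_smul]

/-- One application of the Duhamel operator costs a factor `2π|t|‖b‖`; iterating gives all the
remainder bounds. -/
theorem norm_smul_integral_le {a : A} (ha : IsSelfAdjoint a) (b : A) (t : ℝ) {Y : ℝ → A} {C : ℝ}
    (hY : ∀ r ∈ Set.Icc (0 : ℝ) 1, ‖Y (t * (1 - r))‖ ≤ C) :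
    ‖(2 * Real.pi * Complex.I * t : ℂ) • ∫ r in (0 : ℝ)..1, Y (t * (1 - r)) * b * phase a (t * r)‖
      ≤ 2 * Real.pi * |t| * ‖b‖ * C := by
  have h1 : ‖∫ r in (0 : ℝ)..1, Y (t * (1 - r)) * b * phase a (t * r)‖ ≤ C * ‖b‖ * |1 - 0| := by
    refine intervalIntegral.norm_integral_le_of_norm_le_const fun r hr => ?_
    rw [Set.uIoc_of_le zero_le_one] at hr
    have hC : 0 ≤ C := (norm_nonneg _).trans (hY r ⟨hr.1.le, hr.2⟩)
    calc _ ≤ ‖Y (t * (1 - r)) * b‖ * ‖phase a (t * r)‖ := norm_mul_le _ _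
      _ ≤ ‖Y (t * (1 - r)) * b‖ * 1 := by gcongr; exact norm_phase_le ha _
      _ ≤ C * ‖b‖ := by
        rw [mul_one]
        refine (norm_mul_le _ _).trans ?_
        gcongr
        exact hY r ⟨hr.1.le, hr.2⟩
  rw [norm_smul]
  have h2 : ‖(2 * Real.pi * Complex.I * t : ℂ)‖ = 2 * Real.pi * |t| := by
    simp [abs_of_pos Real.pi_pos]
  rw [h2]
  calc _ ≤ 2 * Real.pi * |t| * (C * ‖b‖ * |1 - 0|) := by gcongr
    _ = _ := by rw [sub_zero, abs_one]; ring

theorem abs_mul_one_sub_le (t : ℝ) {r : ℝ} (hr : r ∈ Set.Icc (0 : ℝ) 1) : |t * (1 - r)| ≤ |t| := by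
  rw [abs_mul]
  refine mul_le_of_le_one_right (abs_nonneg _) ?_
  rw [abs_of_nonneg (by linarith [hr.2])]
  linarith [hr.1]

variable {a b : A}

theorem norm_duhamelOne_le (ha : IsSelfAdjoint a) (t : ℝ) :
    ‖(2 * Real.pi * Complex.I * t : ℂ) • duhamelOne a b t‖ ≤ 2 * Real.pi * |t| * ‖b‖ := by
  have h := norm_smul_integral_le (Y := phase a) ha b t fun r _ => norm_phase_le ha _
  rwa [mul_one] at h

theorem norm_duhamelRemOne_le (ha : IsSelfAdjoint a) (hb : IsSelfAdjoint b) (t : ℝ) :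
    ‖duhamelRemOne a b t‖ ≤ 2 * Real.pi * |t| * ‖b‖ := by
  rw [duhamelRemOne_eq]
  have h := norm_smul_integral_le (Y := phase (a + b)) ha b t fun r _ => norm_phase_le (ha.add hb) _
  rwa [mul_one] at h

theorem norm_duhamelRemTwo_le (ha : IsSelfAdjoint a) (hb : IsSelfAdjoint b) (t : ℝ) :
    ‖duhamelRemTwo a b t‖ ≤ (2 * Real.pi * |t| * ‖b‖) ^ 2 := by
  rw [duhamelRemTwo_eq, sq]
  refine norm_smul_integral_le ha b t fun r hr => (norm_duhamelRemOne_le ha hb _).trans ?_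
  have := abs_mul_one_sub_le t hr
  gcongr

theorem norm_duhamelRemThree_le (ha : IsSelfAdjoint a) (hb : IsSelfAdjoint b) (t : ℝ) :
    ‖duhamelRemThree a b t‖ ≤ (2 * Real.pi * |t| * ‖b‖) ^ 3 := by
  rw [duhamelRemThree_eq, pow_succ']
  refine norm_smul_integral_le ha b t fun r hr => (norm_duhamelRemTwo_le ha hb _).trans ?_
  have := abs_mul_one_sub_le t hr
  gcongr

theorem norm_duhamelTwo_le (ha : IsSelfAdjoint a) (t : ℝ) :
    ‖(2 * Real.pi * Complex.I * t : ℂ) ^ 2 • duhamelTwo a b t‖ ≤ (2 * Real.pi * |t| * ‖b‖) ^ 2 := by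
  have h2 : (2 * Real.pi * Complex.I * t : ℂ) ^ 2 • duhamelTwo a b t
      = (2 * Real.pi * Complex.I * t : ℂ) • ((2 * Real.pi * Complex.I : ℂ) •
        ((t : ℂ) • duhamelTwo a b t)) := by
    simp only [smul_smul]
    congr 1
    ring
  rw [h2, duhamelTwo_eq, ← intervalIntegral.integral_smul, sq]
  have h := norm_smul_integral_le (C := 2 * Real.pi * |t| * ‖b‖)
    (Y := fun u => (2 * Real.pi * Complex.I * u : ℂ) • duhamelOne a b u) ha b t fun r hr => by
      refine (norm_duhamelOne_le ha _).trans ?_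
      have := abs_mul_one_sub_le t hr
      gcongr
  simpa only [smul_mul_assoc, smul_smul] using h

/-- The terms of order at most two in the expansion of `exp (-2πi s (a+b)) x exp (2πi s (a+b))`
determine it up to a third-order error. -/
theorem norm_conj_phase_sub_le (ha : IsSelfAdjoint a) (hb : IsSelfAdjoint b) (x : A) (s : ℝ) :
    ‖phase (a + b) (-s) * x * phase (a + b) s
      - (phase a (-s) * x * phase a s
        - (2 * Real.pi * Complex.I * s : ℂ) • (duhamelOne a b (-s) * x * phase a s)
        + (2 * Real.pi * Complex.I * s : ℂ) • (phase a (-s) * x * duhamelOne a b s)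
        + (2 * Real.pi * Complex.I * s : ℂ) ^ 2 • (duhamelTwo a b (-s) * x * phase a s)
        + (2 * Real.pi * Complex.I * s : ℂ) ^ 2 • (phase a (-s) * x * duhamelTwo a b s)
        - (2 * Real.pi * Complex.I * s : ℂ) ^ 2 • (duhamelOne a b (-s) * x * duhamelOne a b s))‖
      ≤ 4 * (2 * Real.pi * |s| * ‖b‖) ^ 3 * ‖x‖ := by
  set z : ℂ := 2 * Real.pi * Complex.I * s with hz
  set τ : ℝ := 2 * Real.pi * |s| * ‖b‖ with hτ
  have hτ0 : 0 ≤ τ := by positivity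
  have hzn : (2 * Real.pi * Complex.I * (-s : ℝ) : ℂ) = -z := by rw [hz]; push_cast; ring
  have hsn : 2 * Real.pi * |-s| * ‖b‖ = τ := by rw [abs_neg]
  have dm : phase (a + b) (-s) = phase a (-s) - z • duhamelOne a b (-s)
      + z ^ 2 • duhamelTwo a b (-s) + duhamelRemThree a b (-s) := by
    simp only [duhamelRemThree, duhamelRemTwo, duhamelRemOne, hzn, neg_sq, neg_smul]
    abel
  have d1 : phase (a + b) s = phase a s + duhamelRemOne a b s := by simp only [duhamelRemOne]; abel
  have d2 : phase (a + b) s = phase a s + z • duhamelOne a b s + duhamelRemTwo a b s := by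
    simp only [duhamelRemTwo, duhamelRemOne, ← hz]; abel
  have d3 : phase (a + b) s = phase a s + z • duhamelOne a b s + z ^ 2 • duhamelTwo a b s
      + duhamelRemThree a b s := by
    simp only [duhamelRemThree, duhamelRemTwo, duhamelRemOne, ← hz]; abel
  -- The left exponential is expanded with a third-order remainder, and next to its term of order
  -- `k` the right one with a remainder of order `3 - k`. This leaves four error terms, each of
  -- total order three, whence the constant 4.
  have key : phase (a + b) (-s) * x * phase (a + b) s
      - (phase a (-s) * x * phase a s
        - z • (duhamelOne a b (-s) * x * phase a s)
        + z • (phase a (-s) * x * duhamelOne a b s)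
        + z ^ 2 • (duhamelTwo a b (-s) * x * phase a s)
        + z ^ 2 • (phase a (-s) * x * duhamelTwo a b s)
        - z ^ 2 • (duhamelOne a b (-s) * x * duhamelOne a b s))
      = duhamelRemThree a b (-s) * x * phase (a + b) s
        + (z ^ 2 • duhamelTwo a b (-s)) * x * duhamelRemOne a b s
        - (z • duhamelOne a b (-s)) * x * duhamelRemTwo a b s
        + phase a (-s) * x * duhamelRemThree a b s := by
    have e0 : phase (a + b) (-s) * x * phase (a + b) s
        = phase a (-s) * x * phase (a + b) s - (z • duhamelOne a b (-s)) * x * phase (a + b) s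
          + (z ^ 2 • duhamelTwo a b (-s)) * x * phase (a + b) s
          + duhamelRemThree a b (-s) * x * phase (a + b) s := by
      rw [dm]; simp only [sub_mul, add_mul]
    have e1 : phase a (-s) * x * phase (a + b) s = phase a (-s) * x * phase a s
        + z • (phase a (-s) * x * duhamelOne a b s) + z ^ 2 • (phase a (-s) * x * duhamelTwo a b s)
        + phase a (-s) * x * duhamelRemThree a b s := by
      rw [d3]; simp only [mul_add, mul_smul_comm]
    have e2 : (z • duhamelOne a b (-s)) * x * phase (a + b) s
        = z • (duhamelOne a b (-s) * x * phase a s)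
          + z ^ 2 • (duhamelOne a b (-s) * x * duhamelOne a b s)
          + (z • duhamelOne a b (-s)) * x * duhamelRemTwo a b s := by
      rw [d2]; simp only [mul_add, mul_smul_comm, smul_mul_assoc, smul_smul, sq]
    have e3 : (z ^ 2 • duhamelTwo a b (-s)) * x * phase (a + b) s
        = z ^ 2 • (duhamelTwo a b (-s) * x * phase a s)
          + (z ^ 2 • duhamelTwo a b (-s)) * x * duhamelRemOne a b s := by
      rw [d1]; simp only [mul_add, smul_mul_assoc]
    rw [e0, e1, e2, e3]
    abel
  have tri (u v : A) {p q : ℝ} (hu : ‖u‖ ≤ p) (hv : ‖v‖ ≤ q) (hp : 0 ≤ p) :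
      ‖u * x * v‖ ≤ p * q * ‖x‖ := by
    calc ‖u * x * v‖ ≤ ‖u‖ * ‖x‖ * ‖v‖ := by
          refine (norm_mul_le _ _).trans ?_
          gcongr
          exact norm_mul_le _ _
      _ ≤ p * ‖x‖ * q := by gcongr
      _ = p * q * ‖x‖ := by ring
  have b1 := tri (duhamelRemThree a b (-s)) (phase (a + b) s)
    (hsn ▸ norm_duhamelRemThree_le ha hb (-s)) (norm_phase_le (ha.add hb) s) (by positivity)
  have n2 := norm_duhamelTwo_le (b := b) ha (-s)
  rw [hzn, neg_sq, hsn] at n2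
  have b2 := tri _ _ n2 (norm_duhamelRemOne_le ha hb s) (by positivity)
  have n1 := norm_duhamelOne_le (b := b) ha (-s)
  rw [hzn, neg_smul, norm_neg, hsn] at n1
  have b3 := tri _ _ n1 (norm_duhamelRemTwo_le ha hb s) hτ0
  have b4 := tri _ _ (norm_phase_le ha (-s)) (norm_duhamelRemThree_le ha hb s) zero_le_one
  rw [key]
  refine (norm_add_le _ _).trans ((add_le_add_left ((norm_sub_le _ _).trans
    (add_le_add_left (norm_add_le _ _) _)) _).trans ?_)
  calc _ ≤ τ ^ 3 * 1 * ‖x‖ + τ ^ 2 * τ * ‖x‖ + τ * τ ^ 2 * ‖x‖ + 1 * τ ^ 3 * ‖x‖ := by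
        gcongr
    _ = _ := by ring

end Duhamel

end NablaExpansion

namespace NablaExpansion

open MeasureTheory

/-! ### Matching divided differences with Duhamel terms. -/

section Terms

variable {A : Type*} [CStarAlgebra A]

theorem contract_phases_one (a b : A) (s : ℝ) (ξ : Fin 1 → ℝ) :
    contract (elem fun i => phase a (s * slotExponent ξ i)) ![b]
      = phase a (s * -ξ 0) * b * phase a (s * ξ 0) := by
  rw [contract_elem_one]
  simp [slotExponent, Fin.snoc]

theorem contract_phases_two (a b c : A) (s : ℝ) (ξ : Fin 2 → ℝ) :
    contract (elem fun i => phase a (s * slotExponent ξ i)) ![b, c]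
      = phase a (s * -ξ 0) * b * phase a (s * (ξ 0 - ξ 1)) * c * phase a (s * ξ 1) := by
  rw [contract_elem_two]
  rw [show slotExponent ξ 0 = -ξ 0 by simp [slotExponent, Fin.snoc],
    show slotExponent ξ 1 = ξ 0 - ξ 1 from rfl,
    show slotExponent ξ 2 = ξ 1 - 0 from rfl, sub_zero]

theorem contract_phases_three (a b c d : A) (s : ℝ) (ξ : Fin 3 → ℝ) :
    contract (elem fun i => phase a (s * slotExponent ξ i)) ![b, c, d]
      = phase a (s * -ξ 0) * b * phase a (s * (ξ 0 - ξ 1)) * c * phase a (s * (ξ 1 - ξ 2)) * d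
        * phase a (s * ξ 2) := by
  rw [contract_elem_three]
  rw [show slotExponent ξ 0 = -ξ 0 by simp [slotExponent, Fin.snoc],
    show slotExponent ξ 1 = ξ 0 - ξ 1 from rfl, show slotExponent ξ 2 = ξ 1 - ξ 2 from rfl,
    show slotExponent ξ 3 = ξ 2 - 0 from rfl, sub_zero]

theorem dividedDiff_zero (f : ℝ → ℂ) (z : ℝ) : dividedDiff f ![z] = f z := by
  refine (integral_simplex_zero fun s : Fin 0 → ℝ =>
    iteratedDeriv 0 f ((1 - ∑ j, s j) * z + ∑ j, s j * ![z] j.succ)).trans ?_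
  simp

theorem dividedDiff_one (f : ℝ → ℂ) (z w : ℝ) :
    dividedDiff f ![z, w] = ∫ r in (0 : ℝ)..1, deriv f ((1 - r) * z + r * w) := by
  rw [← integral_simplex_one fun r => deriv f ((1 - r) * z + r * w)]
  simp [dividedDiff, simplex]

theorem dividedDiff_one_eq_div (f : 𝓢(ℝ, ℂ)) {z w : ℝ} (h : z ≠ w) :
    dividedDiff f ![z, w] = (f z - f w) / ((z - w : ℝ) : ℂ) := by
  rw [dividedDiff_one]
  have hd : ∀ r : ℝ, HasDerivAt (fun r : ℝ => f ((1 - r) * z + r * w))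
      ((w - z) • deriv f ((1 - r) * z + r * w)) r := by
    intro r
    have h1 : HasDerivAt (fun r : ℝ => (1 - r) * z + r * w) (w - z) r := by
      have h2 := (((hasDerivAt_id r).const_sub 1).mul_const z).add ((hasDerivAt_id r).mul_const w)
      exact h2.congr_deriv (by ring)
    exact f.differentiableAt.hasDerivAt.scomp r h1
  have hc : Continuous (deriv f) := (SchwartzMap.derivCLM ℂ ℂ f).continuous
  have h1 := intervalIntegral.integral_eq_sub_of_hasDerivAt (a := 0) (b := 1) (fun r _ => hd r)
    (Continuous.intervalIntegrable (by fun_prop) _ _)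
  rw [intervalIntegral.integral_smul] at h1
  simp only [sub_self, zero_mul, one_mul, zero_add, sub_zero, add_zero] at h1
  have hne : ((z - w : ℝ) : ℂ) ≠ 0 := by exact_mod_cast sub_ne_zero.2 h
  rw [eq_div_iff hne, ← neg_sub (f w), ← h1, ← Complex.coe_smul, smul_eq_mul]
  push_cast
  ring

theorem nablaApply_eq {a : A} (ha : IsSelfAdjoint a) (f : 𝓢(ℝ, ℂ)) (x : A) :
    Integrable (fun s : ℝ => 𝓕 f s • (phase a (-s) * x * phase a s)) ∧
    nablaApply f a x = ∫ s : ℝ, 𝓕 f s • (phase a (-s) * x * phase a s) := by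
  have h := contract_nablaCalc_dividedDiff ha f (m := 0) (n := 1) (v := fun _ => !₂[1])
    continuous_const (X := fun y => ![y 0]) (fun t y => by simp) ![x]
  simp only [dividedDiff_zero, contract_phases_one] at h
  simpa [integral_simplex_zero (E := A), nablaApply] using h

/-- The frequency `(1 - r, 1)` gives slot exponents `-(1 - r), -r, 1`, the Duhamel integrand at time
`-s`. The prefactor is `2πis` rather than `-2πis`, which accounts for the minus sign of this term in
the expansion. -/
theorem nablaCalc_term_bx {a : A} (ha : IsSelfAdjoint a) (f : 𝓢(ℝ, ℂ)) (b x : A) :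
    Integrable (fun s : ℝ => (2 * Real.pi * Complex.I * s * 𝓕 f s) •
      (duhamelOne a b (-s) * x * phase a s)) ∧
    contract (nablaCalc (n := 2) a fun y => dividedDiff f ![y 0 + y 1, y 1]) ![b, x]
      = ∫ s : ℝ, (2 * Real.pi * Complex.I * s * 𝓕 f s) •
          (duhamelOne a b (-s) * x * phase a s) := by
  have hP := continuous_phase a
  have h := contract_nablaCalc_dividedDiff ha f (m := 1) (n := 2)
    (v := fun t => !₂[1 - t 0, 1]) (by fun_prop) (X := fun y => ![y 0 + y 1, y 1])
    (fun t y => by simp [Fin.sum_univ_two]; ring) ![b, x]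
  have e (s : ℝ) : ∫ t in simplex 1, contract (elem fun i => phase a
      (s * slotExponent (!₂[1 - t 0, 1] : EuclideanSpace ℝ (Fin 2)).ofLp i)) ![b, x]
      = duhamelOne a b (-s) * x * phase a s := by
    simp only [contract_phases_two]
    refine (integral_simplex_one fun r => phase a (s * -(1 - r)) * b * phase a (s * (1 - r - 1)) * x
      * phase a (s * 1)).trans ?_
    have h4 := integral_mul_mul (p := 0) (q := 1) 1 (x * phase a s)
      (Y := fun r => phase a (-s * (1 - r)) * b * phase a (-s * r)) (by fun_prop)
    rw [one_mul, ← mul_assoc] at h4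
    rw [duhamelOne, ← h4]
    refine intervalIntegral.integral_congr fun r _ => ?_
    rw [show s * -(1 - r) = -s * (1 - r) by ring, show s * (1 - r - 1) = -s * r by ring]
    simp only [mul_assoc, one_mul, mul_one]
  simpa only [e, pow_one] using h

theorem nablaCalc_term_xb {a : A} (ha : IsSelfAdjoint a) (f : 𝓢(ℝ, ℂ)) (b x : A) :
    Integrable (fun s : ℝ => (2 * Real.pi * Complex.I * s * 𝓕 f s) •
      (phase a (-s) * x * duhamelOne a b s)) ∧
    contract (nablaCalc (n := 2) a fun y => dividedDiff f ![y 0 + y 1, y 0]) ![x, b]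
      = ∫ s : ℝ, (2 * Real.pi * Complex.I * s * 𝓕 f s) •
          (phase a (-s) * x * duhamelOne a b s) := by
  have hP := continuous_phase a
  have h := contract_nablaCalc_dividedDiff ha f (m := 1) (n := 2)
    (v := fun t => !₂[1, 1 - t 0]) (by fun_prop) (X := fun y => ![y 0 + y 1, y 0])
    (fun t y => by simp [Fin.sum_univ_two]; ring) ![x, b]
  have e (s : ℝ) : ∫ t in simplex 1, contract (elem fun i => phase a
      (s * slotExponent (!₂[1, 1 - t 0] : EuclideanSpace ℝ (Fin 2)).ofLp i)) ![x, b]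
      = phase a (-s) * x * duhamelOne a b s := by
    simp only [contract_phases_two]
    refine (integral_simplex_one fun r => phase a (s * -1) * x * phase a (s * (1 - (1 - r))) * b
      * phase a (s * (1 - r))).trans ?_
    have h4 := integral_mul_mul (p := 0) (q := 1) (phase a (-s) * x) 1
      (Y := fun r => phase a (s * (1 - r)) * b * phase a (s * r)) (by fun_prop)
    rw [mul_one] at h4
    rw [duhamelOne, ← h4]
    -- The order of the nodes parametrises the Duhamel integral backwards; `r ↦ 1 - r` restores it.
    have h5 := intervalIntegral.integral_comp_sub_left (a := 0) (b := 1) (fun r =>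
      phase a (-s) * x * (phase a (s * (1 - r)) * b * phase a (s * r)) * 1) 1
    rw [sub_zero, sub_self] at h5
    rw [← h5]
    refine intervalIntegral.integral_congr fun r _ => ?_
    simp only [mul_assoc, mul_one, mul_neg]
  simpa only [e, pow_one] using h

theorem nablaCalc_term_bbx {a : A} (ha : IsSelfAdjoint a) (f : 𝓢(ℝ, ℂ)) (b x : A) :
    Integrable (fun s : ℝ => ((2 * Real.pi * Complex.I * s) ^ 2 * 𝓕 f s) •
      (duhamelTwo a b (-s) * x * phase a s)) ∧
    contract (nablaCalc (n := 3) a fun y =>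
        dividedDiff f ![y 0 + y 1 + y 2, y 1 + y 2, y 2]) ![b, b, x]
      = ∫ s : ℝ, ((2 * Real.pi * Complex.I * s) ^ 2 * 𝓕 f s) •
          (duhamelTwo a b (-s) * x * phase a s) := by
  have hP := continuous_phase a
  have h := contract_nablaCalc_dividedDiff ha f (m := 2) (n := 3)
    (v := fun t => !₂[1 - (t 0 + t 1), 1 - t 1, 1]) (by fun_prop)
    (X := fun y => ![y 0 + y 1 + y 2, y 1 + y 2, y 2])
    (fun t y => by simp [Fin.sum_univ_succ]; ring) ![b, b, x]
  have e (s : ℝ) : ∫ t in simplex 2, contract (elem fun i => phase a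
      (s * slotExponent (!₂[1 - (t 0 + t 1), 1 - t 1, 1] : EuclideanSpace ℝ (Fin 3)).ofLp i))
      ![b, b, x] = duhamelTwo a b (-s) * x * phase a s := by
    simp only [contract_phases_three]
    refine (integral_simplex_two (G := fun p q => phase a (s * -(1 - (p + q))) * b
      * phase a (s * (1 - (p + q) - (1 - q))) * b * phase a (s * (1 - q - 1)) * x
      * phase a (s * 1)) (by fun_prop)).trans ?_
    have h4 := integral_mul_mul (p := 0) (q := 1) 1 (x * phase a s)
      (Y := fun q => ∫ p in (0 : ℝ)..(1 - q), phase a (-s * (1 - (p + q))) * b * phase a (-s * p)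
        * b * phase a (-s * q))
      (intervalIntegral.continuous_parametric_intervalIntegral_of_continuous
        (by unfold Function.uncurry; fun_prop) (by fun_prop))
    rw [one_mul, ← mul_assoc] at h4
    rw [duhamelTwo, ← h4]
    refine intervalIntegral.integral_congr fun q _ => ?_
    rw [← integral_mul_mul _ _ (by fun_prop)]
    refine intervalIntegral.integral_congr fun p _ => ?_
    rw [show s * -(1 - (p + q)) = -s * (1 - (p + q)) by ring,
      show s * (1 - (p + q) - (1 - q)) = -s * p by ring, show s * (1 - q - 1) = -s * q by ring]
    simp only [mul_assoc, one_mul, mul_one]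
  simpa only [e] using h

theorem nablaCalc_term_xbb {a : A} (ha : IsSelfAdjoint a) (f : 𝓢(ℝ, ℂ)) (b x : A) :
    Integrable (fun s : ℝ => ((2 * Real.pi * Complex.I * s) ^ 2 * 𝓕 f s) •
      (phase a (-s) * x * duhamelTwo a b s)) ∧
    contract (nablaCalc (n := 3) a fun y =>
        dividedDiff f ![y 0, y 0 + y 1, y 0 + y 1 + y 2]) ![x, b, b]
      = ∫ s : ℝ, ((2 * Real.pi * Complex.I * s) ^ 2 * 𝓕 f s) •
          (phase a (-s) * x * duhamelTwo a b s) := by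
  have hP := continuous_phase a
  have h := contract_nablaCalc_dividedDiff ha f (m := 2) (n := 3)
    (v := fun t => !₂[1, t 0 + t 1, t 1]) (by fun_prop)
    (X := fun y => ![y 0, y 0 + y 1, y 0 + y 1 + y 2])
    (fun t y => by simp [Fin.sum_univ_succ]; ring) ![x, b, b]
  have e (s : ℝ) : ∫ t in simplex 2, contract (elem fun i => phase a
      (s * slotExponent (!₂[1, t 0 + t 1, t 1] : EuclideanSpace ℝ (Fin 3)).ofLp i))
      ![x, b, b] = phase a (-s) * x * duhamelTwo a b s := by
    simp only [contract_phases_three]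
    refine (integral_simplex_two (G := fun p q => phase a (s * -1) * x
      * phase a (s * (1 - (p + q))) * b * phase a (s * (p + q - q)) * b
      * phase a (s * q)) (by fun_prop)).trans ?_
    have h4 := integral_mul_mul (p := 0) (q := 1) (phase a (-s) * x) 1
      (Y := fun q => ∫ p in (0 : ℝ)..(1 - q), phase a (s * (1 - (p + q))) * b * phase a (s * p)
        * b * phase a (s * q))
      (intervalIntegral.continuous_parametric_intervalIntegral_of_continuous
        (by unfold Function.uncurry; fun_prop) (by fun_prop))
    rw [mul_one] at h4
    rw [duhamelTwo, ← h4]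
    refine intervalIntegral.integral_congr fun q _ => ?_
    rw [← integral_mul_mul _ _ (by fun_prop)]
    refine intervalIntegral.integral_congr fun p _ => ?_
    rw [add_sub_cancel_right]
    simp only [mul_assoc, mul_one, mul_neg]
  simpa only [e] using h

theorem duhamelOne_mul_mul_duhamelOne (a b x : A) (s : ℝ) :
    duhamelOne a b (-s) * x * duhamelOne a b s
      = ∫ u in (0 : ℝ)..1, ∫ w in (0 : ℝ)..1, phase a (-s * (1 - u)) * b * phase a (-s * u) * x *
          (phase a (s * (1 - w)) * b * phase a (s * w)) := by
  have hP := continuous_phase a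
  have h1 (u : ℝ) := integral_mul_mul (p := 0) (q := 1)
    (phase a (-s * (1 - u)) * b * phase a (-s * u) * x) 1
    (Y := fun w => phase a (s * (1 - w)) * b * phase a (s * w)) (by fun_prop)
  have h2 := integral_mul_mul (p := 0) (q := 1) 1 (x * duhamelOne a b s)
    (Y := fun u => phase a (-s * (1 - u)) * b * phase a (-s * u)) (by fun_prop)
  simp only [mul_one] at h1
  simp only [one_mul, ← mul_assoc] at h2
  simp_rw [h1]
  exact h2.symm

/-- Let `u` and `w` be the Duhamel parameters to the left and right of `x`. The first divided
difference integrates over `u ≤ w`, through `u = t₁`, `w = t₀ + t₁`; the second integrates over `w ≤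
u`, with the roles exchanged. Only the sum over the whole square factors. -/
theorem nablaCalc_term_bxb {a : A} (ha : IsSelfAdjoint a) (f : 𝓢(ℝ, ℂ)) (b x : A) :
    Integrable (fun s : ℝ => ((2 * Real.pi * Complex.I * s) ^ 2 * 𝓕 f s) •
      (duhamelOne a b (-s) * x * duhamelOne a b s)) ∧
    contract (nablaCalc (n := 3) a fun y =>
        dividedDiff f ![y 0 + y 1, y 0 + y 1 + y 2, y 1 + y 2]) ![b, x, b]
      + contract (nablaCalc (n := 3) a fun y =>
          dividedDiff f ![y 0 + y 1, y 1, y 1 + y 2]) ![b, x, b]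
      = ∫ s : ℝ, ((2 * Real.pi * Complex.I * s) ^ 2 * 𝓕 f s) •
          (duhamelOne a b (-s) * x * duhamelOne a b s) := by
  have hP := continuous_phase a
  have h := contract_nablaCalc_dividedDiff ha f (m := 2) (n := 3)
    (v := fun t => !₂[1 - t 1, 1, t 0 + t 1]) (by fun_prop)
    (X := fun y => ![y 0 + y 1, y 0 + y 1 + y 2, y 1 + y 2])
    (fun t y => by simp [Fin.sum_univ_succ]; ring) ![b, x, b]
  have h' := contract_nablaCalc_dividedDiff ha f (m := 2) (n := 3)
    (v := fun t => !₂[1 - (t 0 + t 1), 1, t 1]) (by fun_prop)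
    (X := fun y => ![y 0 + y 1, y 1, y 1 + y 2])
    (fun t y => by simp [Fin.sum_univ_succ]; ring) ![b, x, b]
  let Q (s u w : ℝ) : A := phase a (-s * (1 - u)) * b * phase a (-s * u) * x *
    (phase a (s * (1 - w)) * b * phase a (s * w))
  have hQ (s : ℝ) : Continuous fun p : ℝ × ℝ => Q s p.1 p.2 := by fun_prop
  have hQ' (s u : ℝ) : Continuous fun w => Q s u w := by fun_prop
  have e (s : ℝ) : ∫ t in simplex 2, contract (elem fun i => phase a
      (s * slotExponent (!₂[1 - t 1, 1, t 0 + t 1] : EuclideanSpace ℝ (Fin 3)).ofLp i))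
      ![b, x, b] = ∫ u in (0 : ℝ)..1, ∫ w in u..1, Q s u w := by
    simp only [contract_phases_three]
    refine (integral_simplex_two (G := fun p q => phase a (s * -(1 - q)) * b
      * phase a (s * (1 - q - 1)) * x * phase a (s * (1 - (p + q))) * b
      * phase a (s * (p + q))) (by fun_prop)).trans ?_
    refine intervalIntegral.integral_congr fun q _ => ?_
    have h5 := intervalIntegral.integral_comp_add_right (a := 0) (b := 1 - q)
      (fun w => Q s q w) q
    rw [zero_add, sub_add_cancel] at h5
    rw [← h5]
    refine intervalIntegral.integral_congr fun p _ => ?_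
    simp only [Q]
    rw [show s * -(1 - q) = -s * (1 - q) by ring, show s * (1 - q - 1) = -s * q by ring]
    simp only [mul_assoc]
  have e' (s : ℝ) : ∫ t in simplex 2, contract (elem fun i => phase a
      (s * slotExponent (!₂[1 - (t 0 + t 1), 1, t 1] : EuclideanSpace ℝ (Fin 3)).ofLp i))
      ![b, x, b] = ∫ u in (0 : ℝ)..1, ∫ w in (0 : ℝ)..u, Q s u w := by
    rw [← integral_triangle_swap (hQ s)]
    simp only [contract_phases_three]
    refine (integral_simplex_two (G := fun p q => phase a (s * -(1 - (p + q))) * b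
      * phase a (s * (1 - (p + q) - 1)) * x * phase a (s * (1 - q)) * b
      * phase a (s * q)) (by fun_prop)).trans ?_
    refine intervalIntegral.integral_congr fun q _ => ?_
    have h5 := intervalIntegral.integral_comp_add_right (a := 0) (b := 1 - q)
      (fun u => Q s u q) q
    rw [zero_add, sub_add_cancel] at h5
    rw [← h5]
    refine intervalIntegral.integral_congr fun p _ => ?_
    simp only [Q]
    rw [show s * -(1 - (p + q)) = -s * (1 - (p + q)) by ring,
      show s * (1 - (p + q) - 1) = -s * (p + q) by ring]
    simp only [mul_assoc]
  have esum (s : ℝ) : (∫ u in (0 : ℝ)..1, ∫ w in u..1, Q s u w)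
      + (∫ u in (0 : ℝ)..1, ∫ w in (0 : ℝ)..u, Q s u w)
      = duhamelOne a b (-s) * x * duhamelOne a b s := by
    rw [duhamelOne_mul_mul_duhamelOne, ← intervalIntegral.integral_add]
    · refine intervalIntegral.integral_congr fun u _ => ?_
      rw [add_comm]
      exact intervalIntegral.integral_add_adjacent_intervals
        ((hQ' s u).intervalIntegrable _ _) ((hQ' s u).intervalIntegrable _ _)
    · have h6 : Continuous fun u => ∫ w in (1 : ℝ)..u, Q s u w :=
        intervalIntegral.continuous_parametric_intervalIntegral_of_continuous (hQ s) continuous_id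
      -- Reversing orientation moves the variable endpoint to the top, where the continuity
      -- statement for parametric integrals applies.
      simp_rw [fun u : ℝ => intervalIntegral.integral_symm (f := fun w => Q s u w) (μ := volume) 1 u]
      exact h6.neg.intervalIntegrable _ _
    · exact (intervalIntegral.continuous_parametric_intervalIntegral_of_continuous (hQ s)
        continuous_id).intervalIntegrable _ _
  simp only [e] at h
  simp only [e'] at h'
  rw [h.2, h'.2, ← integral_add h.1 h'.1]
  have h7 := h.1.add h'.1
  simp only [← smul_add, esum]
  refine ⟨h7.congr (.of_forall fun s => ?_), trivial⟩
  simp only [Pi.add_apply, ← smul_add, esum]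

end Terms

end NablaExpansion

namespace NablaExpansion

open MeasureTheory

/-! ### The cubic error bound. -/

section Expansion

variable {A : Type*} [CStarAlgebra A]

theorem integrable_cubic_bound (f : 𝓢(ℝ, ℂ)) (β ξ : ℝ) :
    Integrable fun s : ℝ => ‖𝓕 f s‖ * (4 * (2 * Real.pi * |s| * β) ^ 3 * ξ) := by
  refine (((𝓕 f).integrable_pow_mul volume 3).const_mul
    (4 * (2 * Real.pi * β) ^ 3 * ξ)).congr (.of_forall fun s => ?_)
  simp only [Real.norm_eq_abs]
  ring

/-- Every term is an integral over the same `s` weighted by `𝓕 f s`, so the difference is one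
integral, bounded pointwise by the expansion of the conjugation. -/
theorem norm_nablaApply_add_sub_le {a b : A} (ha : IsSelfAdjoint a) (hb : IsSelfAdjoint b)
    (f : 𝓢(ℝ, ℂ)) (x : A) :
    ‖nablaApply f (a + b) x -
        (nablaApply f a x
          - contract (nablaCalc (n := 2) a fun y => dividedDiff f ![y 0 + y 1, y 1]) ![b, x]
          + contract (nablaCalc (n := 2) a fun y => dividedDiff f ![y 0 + y 1, y 0]) ![x, b]
          + contract (nablaCalc (n := 3) a fun y =>
              dividedDiff f ![y 0 + y 1 + y 2, y 1 + y 2, y 2]) ![b, b, x]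
          + contract (nablaCalc (n := 3) a fun y =>
              dividedDiff f ![y 0, y 0 + y 1, y 0 + y 1 + y 2]) ![x, b, b]
          - contract (nablaCalc (n := 3) a fun y =>
              dividedDiff f ![y 0 + y 1, y 0 + y 1 + y 2, y 1 + y 2]) ![b, x, b]
          - contract (nablaCalc (n := 3) a fun y =>
              dividedDiff f ![y 0 + y 1, y 1, y 1 + y 2]) ![b, x, b])‖
      ≤ ∫ s : ℝ, ‖𝓕 f s‖ * (4 * (2 * Real.pi * |s| * ‖b‖) ^ 3 * ‖x‖) := by
  obtain ⟨i, e⟩ := nablaApply_eq (ha.add hb) f x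
  obtain ⟨i0, e0⟩ := nablaApply_eq ha f x
  obtain ⟨i1, e1⟩ := nablaCalc_term_bx ha f b x
  obtain ⟨i2, e2⟩ := nablaCalc_term_xb ha f b x
  obtain ⟨i3, e3⟩ := nablaCalc_term_bbx ha f b x
  obtain ⟨i4, e4⟩ := nablaCalc_term_xbb ha f b x
  obtain ⟨i5, e5⟩ := nablaCalc_term_bxb ha f b x
  -- The two `b·x·b` terms are grouped first, since only their sum has been identified.
  rw [sub_sub _ (contract _ ![b, x, b]), e, e0, e1, e2, e3, e4, e5, ← integral_sub' i0 i1,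
    ← integral_add' (i0.sub i1) i2, ← integral_add' ((i0.sub i1).add i2) i3,
    ← integral_add' (((i0.sub i1).add i2).add i3) i4,
    ← integral_sub' ((((i0.sub i1).add i2).add i3).add i4) i5,
    ← integral_sub' i (((((i0.sub i1).add i2).add i3).add i4).sub i5)]
  refine norm_integral_le_of_norm_le (integrable_cubic_bound f ‖b‖ ‖x‖) (.of_forall fun s => ?_)
  refine le_trans (le_of_eq ?_)
    (mul_le_mul_of_nonneg_left (norm_conj_phase_sub_le ha hb x s) (norm_nonneg _))
  rw [← norm_smul]
  congr 1
  simp only [smul_sub, smul_add, smul_smul, Pi.add_apply, Pi.sub_apply, mul_comm (𝓕 f s)]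

end Expansion

end NablaExpansion

end

open NablaExpansion in
theorem mainTheorem7 {A : Type*} [CStarAlgebra A] (a x : A) (ha : IsSelfAdjoint a)
    (hx : IsSelfAdjoint x) (f : 𝓢(ℝ, ℂ)) :
    ((fun b : A => nablaApply f (a + b) x -
        (nablaApply f a x
          - contract (nablaCalc (n := 2) a fun y => dividedDiff f ![y 0 + y 1, y 1]) ![b, x]
          + contract (nablaCalc (n := 2) a fun y => dividedDiff f ![y 0 + y 1, y 0]) ![x, b]
          + contract (nablaCalc (n := 3) a fun y =>
              dividedDiff f ![y 0 + y 1 + y 2, y 1 + y 2, y 2]) ![b, b, x]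
          + contract (nablaCalc (n := 3) a fun y =>
              dividedDiff f ![y 0, y 0 + y 1, y 0 + y 1 + y 2]) ![x, b, b]
          - contract (nablaCalc (n := 3) a fun y =>
              dividedDiff f ![y 0 + y 1, y 0 + y 1 + y 2, y 1 + y 2]) ![b, x, b]
          - contract (nablaCalc (n := 3) a fun y =>
              dividedDiff f ![y 0 + y 1, y 1, y 1 + y 2]) ![b, x, b]))
      =O[𝓝[{b : A | IsSelfAdjoint b}] 0] (fun b : A => ‖b‖ ^ 3))
    ∧ (∀ s t : ℝ, s ≠ 0 → -dividedDiff f ![s + t, t] = -((f (s + t) - f t) / s))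
    ∧ (∀ s t : ℝ, t ≠ 0 → dividedDiff f ![s + t, s] = (f (s + t) - f s) / t) := by
  refine ⟨?_, fun s t hs => ?_, fun s t ht => ?_⟩
  -- The constant is the cubic bound with `‖b‖` replaced by 1, because `‖b‖³` factors out of the
  -- integral. The bound holds for every selfadjoint `b`, not just small ones.
  · refine Asymptotics.IsBigO.of_bound
      (∫ s : ℝ, ‖𝓕 f s‖ * (4 * (2 * Real.pi * |s| * 1) ^ 3 * ‖x‖)) ?_
    filter_upwards [self_mem_nhdsWithin] with b hb
    refine (norm_nablaApply_add_sub_le ha hb f x).trans (le_of_eq ?_)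
    rw [← MeasureTheory.integral_mul_const, norm_pow, norm_norm]
    refine MeasureTheory.integral_congr_ae (.of_forall fun s => ?_)
    simp only
    ring
  · rw [dividedDiff_one_eq_div f (by simpa using hs), add_sub_cancel_right]
  · rw [dividedDiff_one_eq_div f (by simpa using ht), add_sub_cancel_left]
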